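/- Let $\Bbbk$ be an algebraically closed field of characteristic $0$, let $G_1,G_2$ be connected affine algebraic groups over $\Bbbk$ with Lie algebras $\mathfrak g_1,\mathfrak g_2$, and let $V_1,V_2$ be finite-dimensional rational modules of $G_1$ and $G_2$, respectively. For an affine algebraic group $G$ with Lie algebra $\mathfrak g$ and a finite-dimensional rational $G$-module $V$, put $V_{\mathsf{reg}}=\{v\in V\mid \dim G\cdot v\ge \dim G\cdot v' \text{ for all } v'\in V\}$. The codimension-$2$ condition holds for $(G:V)$ if $\operatorname{codim}_V(V\setminus V_{\mathsf{reg}})\ge 2$ (this includes the case $V_{\mathsf{reg}}=V$). For $v\in V$ let $\mathfrak g_v=\{s\in\mathfrak g\mid s\cdot v=0\}$. If there is a dense (Zariski) open subset $\Omega\subset V$ such that the subalgebras $\mathfrak g_v$, $v\in\Omega$, are all $G$-conjugate, then $(G:V)$ is said to have a generic stabiliser, and each $\mathfrak g_v$ with $v\in\Omega$ is called a generic stabiliser, denoted $\mathsf{g.s.}(\mathfrak g:V)$. **Theorem.** Let $d=\dim V_2$. Suppose that the codimension-$2$ condition holds for $(G_1\times G_2: V_1\otimes V_2)$, where $(g_1,g_2)\cdot(v_1\otimes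 v_2)=g_1v_1\otimes g_2v_2$. Suppose also that $(G_1\times G_2:V_1\otimes V_2)$ and $(G_1:V_1^{\oplus d})$ have generic stabilisers and that these coincide as Lie algebras, that is, $$\mathsf{g.s.}(\mathfrak g_1\times\mathfrak g_2: V_1\otimes V_2)\simeq\mathsf{g.s.}(\mathfrak g_1: V_1^{\oplus d}).$$ (In particular, this holds if they are equal as subalgebras of $\mathfrak g_1\times\mathfrak g_2\supset\mathfrak g_1$.) Then the codimension-$2$ condition also holds for $(G_1: V_1^{\oplus d})$. -/

import Mathlib

open scoped TensorProduct

namespace CodimTwo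

universe u v w

noncomputable section

/-! ### Zariski topology and dimension on a set with a given ring of regular functions -/

section Zariski

variable {k : Type u} [Field k] {X : Type v} {Y : Type w}

/-- The Zariski topology defined by a `k`-algebra `A` of functions on `X`: the sets
`{x | f x ≠ 0}`, `f ∈ A`, form a basis of open sets. -/
@[reducible] def zariski (A : Subalgebra k (X → k)) : TopologicalSpace X :=
  TopologicalSpace.generateFrom {U | ∃ f ∈ A, U = {x | f x ≠ 0}}

/-- The ideal of the functions in `A` that vanish on `S`. -/
def vanishingIdeal (A : Subalgebra k (X → k)) (S : Set X) : Ideal A where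
  carrier := {f | ∀ x ∈ S, f.1 x = 0}
  add_mem' := fun {f g} hf hg x hx => by
    show f.1 x + g.1 x = 0
    rw [hf x hx, hg x hx, add_zero]
  zero_mem' := fun _ _ => rfl
  smul_mem' := fun c f hf x hx => by
    show c.1 x * f.1 x = 0
    rw [hf x hx, mul_zero]

/-- The dimension of (the Zariski closure of) `S`, that is, the Krull dimension of the
coordinate ring `A / I(S)` of the closure. It is `⊥` if `S` is empty. -/
def zariskiDim (A : Subalgebra k (X → k)) (S : Set X) : WithBot ℕ∞ :=
  ringKrullDim (A ⧸ vanishingIdeal A S)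

/-- Pulling back `k`-valued functions along a map. -/
def pullback (k : Type u) [Field k] (φ : X → Y) : (Y → k) →ₐ[k] (X → k) where
  toFun f := fun x => f (φ x)
  map_one' := rfl
  map_mul' _ _ := rfl
  map_zero' := rfl
  map_add' _ _ := rfl
  commutes' _ := rfl

/-- The algebra of regular functions on a product: it is generated by the pull-backs of the
regular functions on the two factors. -/
def prodAlg (A : Subalgebra k (X → k)) (B : Subalgebra k (Y → k)) :
    Subalgebra k (X × Y → k) :=
  A.map (pullback k Prod.fst) ⊔ B.map (pullback k Prod.snd)

/-- To map `prodAlg A B` into a subalgebra by a pull-back, it suffices to map `A` and `B`. -/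
theorem pullback_mem_of_prodAlg {Z : Type*} {A : Subalgebra k (X → k)} {B : Subalgebra k (Y → k)}
    {C : Subalgebra k (Z → k)} (φ : Z → X × Y)
    (hA : ∀ a ∈ A, (fun z => a (φ z).1) ∈ C) (hB : ∀ b ∈ B, (fun z => b (φ z).2) ∈ C)
    {F : X × Y → k} (hF : F ∈ prodAlg A B) : (fun z => F (φ z)) ∈ C := by
  have h : prodAlg A B ≤ C.comap (pullback k φ) := by
    refine sup_le ?_ ?_
    · rintro _ ⟨a, ha, rfl⟩
      exact hA a ha
    · rintro _ ⟨b, hb, rfl⟩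
      exact hB b hb
  exact h hF

/-- The algebra `k[V]` of polynomial functions on a vector space, generated by the linear forms. -/
def polyFun (k : Type u) [Field k] (V : Type v) [AddCommGroup V] [Module k V] : Subalgebra k (V → k) :=
  Algebra.adjoin k (Set.range fun ℓ : Module.Dual k V => (fun v => ℓ v))

end Zariski

/-! ### Affine algebraic groups -/

section Groups

/-- The structure of an affine algebraic group over `k` on a group `G`: a finitely generated
algebra `k[G]` of `k`-valued functions on `G` such that `G` is the set of all algebra
homomorphisms `k[G] → k` (so that `G` is an affine variety), and for which multiplication
`G × G → G` and inversion `G → G` are morphisms of varieties. -/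
class AffineAlgebraicGroup (k : Type u) [Field k] (G : Type v) [Group G] where
  /-- the algebra `k[G]` of regular functions -/
  coordRing : Subalgebra k (G → k)
  fg : coordRing.FG
  eval_bijective : Function.Bijective
    (fun g : G => ((Pi.evalAlgHom k (fun _ : G => k) g).comp coordRing.val : coordRing →ₐ[k] k))
  mul_regular : ∀ f ∈ coordRing,
    (fun p : G × G => f (p.1 * p.2)) ∈ prodAlg coordRing coordRing
  inv_regular : ∀ f ∈ coordRing, (fun g : G => f g⁻¹) ∈ coordRing

variable (k : Type u) [Field k] (G : Type v) [Group G] [AffineAlgebraicGroup k G]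

/-- The algebra `k[G]` of regular functions on an affine algebraic group. -/
abbrev coordRing : Subalgebra k (G → k) := AffineAlgebraicGroup.coordRing

/-- `G` is connected in its Zariski topology. -/
def IsZariskiConnected : Prop :=
  @ConnectedSpace G (zariski (coordRing k G))

variable {k G}

theorem const_mem {X : Type*} (A : Subalgebra k (X → k)) (c : k) : (fun _ => c) ∈ A :=
  A.algebraMap_mem c

theorem left_mem (g : G) {f : G → k} (hf : f ∈ coordRing k G) :
    (fun x => f (g * x)) ∈ coordRing k G :=
  pullback_mem_of_prodAlg (fun x : G => (g, x)) (fun a _ => const_mem _ (a g))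
    (fun _ hb => hb) (AffineAlgebraicGroup.mul_regular f hf)

theorem right_mem (g : G) {f : G → k} (hf : f ∈ coordRing k G) :
    (fun x => f (x * g)) ∈ coordRing k G :=
  pullback_mem_of_prodAlg (fun x : G => (x, g)) (fun _ ha => ha)
    (fun b _ => const_mem _ (b g)) (AffineAlgebraicGroup.mul_regular f hf)

variable (k)

/-- Left translation of regular functions, `f ↦ (x ↦ f (g x))`. -/
def leftTranslate (g : G) : coordRing k G →ₐ[k] coordRing k G :=
  ((pullback k (fun x : G => g * x)).comp (coordRing k G).val).codRestrict (coordRing k G)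
    (fun f => left_mem g f.2)

/-- Right translation of regular functions, `f ↦ (x ↦ f (x g))`. -/
def rightTranslate (g : G) : coordRing k G →ₐ[k] coordRing k G :=
  ((pullback k (fun x : G => x * g)).comp (coordRing k G).val).codRestrict (coordRing k G)
    (fun f => right_mem g f.2)

variable {k}

@[simp] theorem leftTranslate_apply (g : G) (f : coordRing k G) (x : G) :
    (leftTranslate k g f).1 x = f.1 (g * x) := rfl

@[simp] theorem rightTranslate_apply (g : G) (f : coordRing k G) (x : G) :
    (rightTranslate k g f).1 x = f.1 (x * g) := rfl

theorem coordRing_ext {f f' : coordRing k G} (h : ∀ x, f.1 x = f'.1 x) : f = f' :=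
  Subtype.ext (funext h)

variable (k G)

/-- The Lie algebra of `G`: the left-invariant derivations of `k[G]`, with the commutator. -/
def LieAlg : LieSubalgebra k (Derivation k (coordRing k G) (coordRing k G)) where
  carrier := {D | ∀ (g : G) (f : coordRing k G),
    D (leftTranslate k g f) = leftTranslate k g (D f)}
  add_mem' := fun {D E} hD hE g f => by
    rw [Derivation.add_apply, Derivation.add_apply, hD g f, hE g f, map_add]
  zero_mem' := fun g f => by simp
  smul_mem' := fun c D hD g f => by
    rw [Derivation.smul_apply, Derivation.smul_apply, hD g f, map_smul]
  lie_mem' := fun {D E} hD hE g f => by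
    rw [Derivation.commutator_apply, Derivation.commutator_apply, hE g f, hD g f, hD g (E f),
      hE g (D f), map_sub]

variable {k G}

/-- The adjoint action: `Ad g D = R_g ∘ D ∘ R_{g⁻¹}`, where `R_g` is right translation of functions.
On tangent vectors at the identity it is the differential of `x ↦ g x g⁻¹`. -/
def Ad (g : G) (D : LieAlg k G) : LieAlg k G :=
  ⟨Derivation.mk' ((rightTranslate k g).toLinearMap ∘ₗ (D.1 : coordRing k G →ₗ[k] coordRing k G) ∘ₗ
      (rightTranslate k g⁻¹).toLinearMap) (fun a b => by
      have h : ∀ c : coordRing k G, rightTranslate k g (rightTranslate k g⁻¹ c) = c :=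
        fun c => coordRing_ext fun x => by simp
      simp [h]), by
    intro h f
    have hc : ∀ (y : G) (c : coordRing k G),
        rightTranslate k y (leftTranslate k h c) = leftTranslate k h (rightTranslate k y c) :=
      fun y c => coordRing_ext fun x => by simp [mul_assoc]
    show rightTranslate k g (D.1 (rightTranslate k g⁻¹ (leftTranslate k h f))) =
      leftTranslate k h (rightTranslate k g (D.1 (rightTranslate k g⁻¹ f)))
    rw [hc, D.2 h, hc]⟩

/-- Two subalgebras of the Lie algebra of `G` are `G`-conjugate. -/
def AreConjugate (𝔞 𝔟 : LieSubalgebra k (LieAlg k G)) : Prop :=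
  ∃ g : G, (𝔟 : Set (LieAlg k G)) = Ad g '' (𝔞 : Set (LieAlg k G))

end Groups

/-! ### Products of affine algebraic groups -/

section Product

variable {k : Type u} [Field k] {G : Type v} {H : Type w} [Group G] [Group H]

theorem fst_mem {X : Type*} {Y : Type*} {A : Subalgebra k (X → k)} {B : Subalgebra k (Y → k)}
    {a : X → k} (ha : a ∈ A) : (fun p : X × Y => a p.1) ∈ prodAlg A B :=
  (le_sup_left : A.map (pullback k Prod.fst) ≤ prodAlg A B) ⟨a, ha, rfl⟩

theorem snd_mem {X : Type*} {Y : Type*} {A : Subalgebra k (X → k)} {B : Subalgebra k (Y → k)}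
    {b : Y → k} (hb : b ∈ B) : (fun p : X × Y => b p.2) ∈ prodAlg A B :=
  (le_sup_right : B.map (pullback k Prod.snd) ≤ prodAlg A B) ⟨b, hb, rfl⟩

/-- Two algebra homomorphisms out of `prodAlg A B` agree if they agree on `A` and on `B`. -/
theorem prodAlg_hom_ext {X : Type*} {Y : Type*} {A : Subalgebra k (X → k)}
    {B : Subalgebra k (Y → k)} {φ ψ : prodAlg A B →ₐ[k] k}
    (hA : ∀ (a : X → k) (ha : a ∈ A), φ ⟨_, fst_mem ha⟩ = ψ ⟨_, fst_mem ha⟩)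
    (hB : ∀ (b : Y → k) (hb : b ∈ B), φ ⟨_, snd_mem hb⟩ = ψ ⟨_, snd_mem hb⟩) : φ = ψ := by
  have h : prodAlg A B ≤ (AlgHom.equalizer φ ψ).map (prodAlg A B).val := by
    refine sup_le ?_ ?_
    · rintro _ ⟨a, ha, rfl⟩
      exact ⟨⟨_, fst_mem ha⟩, hA a ha, rfl⟩
    · rintro _ ⟨b, hb, rfl⟩
      exact ⟨⟨_, snd_mem hb⟩, hB b hb, rfl⟩
  ext F
  obtain ⟨F', hF', he⟩ := h F.2
  have : F' = F := Subtype.ext he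
  rw [← this]
  exact hF'

variable [AffineAlgebraicGroup k G] [AffineAlgebraicGroup k H]

/-- The direct product of two affine algebraic groups. -/
instance instProd : AffineAlgebraicGroup k (G × H) where
  coordRing := prodAlg (coordRing k G) (coordRing k H)
  fg := ((AffineAlgebraicGroup.fg (k := k) (G := G)).map _).sup
    ((AffineAlgebraicGroup.fg (k := k) (G := H)).map _)
  eval_bijective := by
    constructor
    · rintro ⟨g, h⟩ ⟨g', h'⟩ e
      have e1 : g = g' := (AffineAlgebraicGroup.eval_bijective (k := k) (G := G)).1 <| by
        ext a
        exact DFunLike.congr_fun e ⟨_, fst_mem a.2⟩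
      have e2 : h = h' := (AffineAlgebraicGroup.eval_bijective (k := k) (G := H)).1 <| by
        ext b
        exact DFunLike.congr_fun e ⟨_, snd_mem b.2⟩
      rw [e1, e2]
    · intro φ
      let i : coordRing k G →ₐ[k] prodAlg (coordRing k G) (coordRing k H) :=
        ((pullback k Prod.fst).comp (coordRing k G).val).codRestrict _ (fun a => fst_mem a.2)
      let j : coordRing k H →ₐ[k] prodAlg (coordRing k G) (coordRing k H) :=
        ((pullback k Prod.snd).comp (coordRing k H).val).codRestrict _ (fun b => snd_mem b.2)
      obtain ⟨g, hg⟩ := (AffineAlgebraicGroup.eval_bijective (k := k) (G := G)).2 (φ.comp i)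
      obtain ⟨h, hh⟩ := (AffineAlgebraicGroup.eval_bijective (k := k) (G := H)).2 (φ.comp j)
      refine ⟨(g, h), prodAlg_hom_ext ?_ ?_⟩
      · intro a ha
        exact DFunLike.congr_fun hg ⟨a, ha⟩
      · intro b hb
        exact DFunLike.congr_fun hh ⟨b, hb⟩
  mul_regular := fun F hF => by
    refine pullback_mem_of_prodAlg
      (fun p : (G × H) × (G × H) => (p.1.1 * p.2.1, p.1.2 * p.2.2)) ?_ ?_ hF
    · intro a ha
      exact pullback_mem_of_prodAlg (fun p : (G × H) × (G × H) => (p.1.1, p.2.1))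
        (fun c hc => fst_mem (fst_mem hc)) (fun c hc => snd_mem (fst_mem hc))
        (AffineAlgebraicGroup.mul_regular a ha)
    · intro b hb
      exact pullback_mem_of_prodAlg (fun p : (G × H) × (G × H) => (p.1.2, p.2.2))
        (fun c hc => fst_mem (snd_mem hc)) (fun c hc => snd_mem (snd_mem hc))
        (AffineAlgebraicGroup.mul_regular b hb)
  inv_regular := fun F hF =>
    pullback_mem_of_prodAlg (fun p : G × H => (p.1⁻¹, p.2⁻¹))
      (fun a ha => fst_mem (AffineAlgebraicGroup.inv_regular a ha))
      (fun b hb => snd_mem (AffineAlgebraicGroup.inv_regular b hb)) hF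

end Product

/-! ### Rational representations -/

section Representations

variable {k : Type u} [Field k] {G : Type v} [Group G] [AffineAlgebraicGroup k G]
  {V : Type w} [AddCommGroup V] [Module k V]

/-- A representation of `G` on `V` (finite-dimensional in all uses below) is rational if all its
matrix coefficients `g ↦ ℓ (g • v)` are regular functions on `G`. -/
class IsRational (ρ : Representation k G V) : Prop where
  coeff_mem : ∀ (ℓ : Module.Dual k V) (v : V), (fun g => ℓ (ρ g v)) ∈ coordRing k G

/-- The matrix coefficient `g ↦ ℓ (g • v)` as an element of `k[G]`. -/
def coeff (ρ : Representation k G V) [IsRational ρ] (ℓ : Module.Dual k V) (v : V) :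
    coordRing k G :=
  ⟨fun g => ℓ (ρ g v), IsRational.coeff_mem ℓ v⟩

variable [FiniteDimensional k V]

/-- `D · v` for `D` in the Lie algebra of `G`: the vector such that `ℓ (D · v)` is, for every
linear form `ℓ`, the derivative at the identity of `g ↦ ℓ (g • v)` in the direction `D`. -/
def lieAct (ρ : Representation k G V) [IsRational ρ] (D : LieAlg k G) (v : V) : V :=
  (Module.evalEquiv k V).symm
    { toFun := fun ℓ => (D.1 (coeff ρ ℓ v)).1 1
      map_add' := fun ℓ ℓ' => by
        have : coeff ρ (ℓ + ℓ') v = coeff ρ ℓ v + coeff ρ ℓ' v := rfl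
        rw [this, map_add]; rfl
      map_smul' := fun c ℓ => by
        have : coeff ρ (c • ℓ) v = c • coeff ρ ℓ v := rfl
        rw [this, Derivation.map_smul]; rfl }

theorem apply_lieAct (ρ : Representation k G V) [IsRational ρ] (D : LieAlg k G) (v : V)
    (ℓ : Module.Dual k V) : ℓ (lieAct ρ D v) = (D.1 (coeff ρ ℓ v)).1 1 := by
  rw [lieAct, Module.apply_evalEquiv_symm_apply]
  rfl

theorem derivation_coeff (ρ : Representation k G V) [IsRational ρ] (D : LieAlg k G) (v : V)
    (ℓ : Module.Dual k V) : D.1 (coeff ρ ℓ v) = coeff ρ ℓ (lieAct ρ D v) := by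
  refine coordRing_ext fun g => ?_
  have h1 : leftTranslate k g (coeff ρ ℓ v) = coeff ρ (ℓ ∘ₗ ρ g) v :=
    coordRing_ext fun x => by simp [coeff]
  have h2 : (leftTranslate k g (D.1 (coeff ρ ℓ v))).1 1 = (D.1 (coeff ρ ℓ v)).1 g := by simp
  rw [← h2, ← D.2 g, h1, ← apply_lieAct]
  rfl

theorem lieAct_ext {x y : V} (h : ∀ ℓ : Module.Dual k V, ℓ x = ℓ y) : x = y :=
  (Module.evalEquiv k V).injective (LinearMap.ext h)

attribute [local instance 100] LieRing.ofAssociativeRing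

/-- The differential `𝔤 → 𝔤𝔩(V)` of a rational representation of `G` on `V`. -/
def differential (ρ : Representation k G V) [IsRational ρ] : LieAlg k G →ₗ⁅k⁆ Module.End k V where
  toFun D :=
    { toFun := lieAct ρ D
      map_add' := fun v w => lieAct_ext (k := k) fun ℓ => by
        have : coeff ρ ℓ (v + w) = coeff ρ ℓ v + coeff ρ ℓ w :=
          coordRing_ext fun x => by simp [coeff]
        rw [map_add, apply_lieAct, apply_lieAct, apply_lieAct, this, map_add]; rfl
      map_smul' := fun c v => lieAct_ext (k := k) fun ℓ => by
        have : coeff ρ ℓ (c • v) = c • coeff ρ ℓ v :=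
          coordRing_ext fun x => by simp [coeff]
        rw [RingHom.id_apply, map_smul, apply_lieAct, apply_lieAct, this, Derivation.map_smul]; rfl }
  map_add' D E := LinearMap.ext fun v => lieAct_ext (k := k) fun ℓ => by
    show ℓ (lieAct ρ (D + E) v) = ℓ (lieAct ρ D v + lieAct ρ E v)
    rw [LinearMap.map_add ℓ, apply_lieAct, apply_lieAct, apply_lieAct]; rfl
  map_smul' c D := LinearMap.ext fun v => lieAct_ext (k := k) fun ℓ => by
    show ℓ (lieAct ρ (c • D) v) = ℓ (c • lieAct ρ D v)
    rw [LinearMap.map_smul ℓ, apply_lieAct, apply_lieAct]; rfl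
  map_lie' {D E} := LinearMap.ext fun v => lieAct_ext (k := k) fun ℓ => by
    show ℓ (lieAct ρ ⁅D, E⁆ v) = ℓ (lieAct ρ D (lieAct ρ E v) - lieAct ρ E (lieAct ρ D v))
    rw [LinearMap.map_sub ℓ, apply_lieAct, apply_lieAct, apply_lieAct, ← derivation_coeff, ← derivation_coeff]
    rfl

/-- The stabiliser `𝔤_v = {D ∈ 𝔤 | D · v = 0}`. -/
def lieStabiliser (ρ : Representation k G V) [IsRational ρ] (v : V) :
    LieSubalgebra k (LieAlg k G) where
  carrier := {D | differential ρ D v = 0}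
  add_mem' := fun {D E} hD hE => by
    show differential ρ (D + E) v = 0
    rw [map_add, LinearMap.add_apply, hD, hE, add_zero]
  zero_mem' := by simp
  smul_mem' := fun c D hD => by
    show differential ρ (c • D) v = 0
    rw [map_smul, LinearMap.smul_apply, hD, smul_zero]
  lie_mem' := fun {D E} hD hE => by
    show differential ρ ⁅D, E⁆ v = 0
    have hD' : differential ρ D v = 0 := hD
    have hE' : differential ρ E v = 0 := hE
    rw [LieHom.map_lie]
    show differential ρ D (differential ρ E v) - differential ρ E (differential ρ D v) = 0
    rw [hD', hE', map_zero, map_zero, sub_zero]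

/-- `𝔥` is a generic stabiliser for `(G : V)`: there is a dense Zariski open subset `Ω` of `V` such
that all stabilisers `𝔤_v`, `v ∈ Ω`, are `G`-conjugate, and `𝔥 = 𝔤_v` for some `v ∈ Ω`. -/
def IsGenericStabiliser (ρ : Representation k G V) [IsRational ρ]
    (𝔥 : LieSubalgebra k (LieAlg k G)) : Prop :=
  ∃ Ω : Set V, @IsOpen V (zariski (polyFun k V)) Ω ∧ @Dense V (zariski (polyFun k V)) Ω ∧
    (∀ v ∈ Ω, ∀ w ∈ Ω, AreConjugate (lieStabiliser ρ v) (lieStabiliser ρ w)) ∧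
    ∃ v ∈ Ω, 𝔥 = lieStabiliser ρ v

end Representations

/-! ### Regular elements and the codimension-`n` condition -/

section Codim

variable {k : Type u} [Field k] {G : Type v} [Group G] {V : Type w} [AddCommGroup V] [Module k V]

/-- The dimension of the orbit `G · v`. -/
def orbitDim (ρ : Representation k G V) (v : V) : WithBot ℕ∞ :=
  zariskiDim (polyFun k V) (Set.range fun g : G => ρ g v)

/-- The set `V_reg` of `G`-regular elements: those whose orbit has maximal dimension. -/
def regularSet (ρ : Representation k G V) : Set V :=
  {v | ∀ v' : V, orbitDim ρ v' ≤ orbitDim ρ v}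

/-- The codimension-`n` condition for `(G : V)`: `codim_V (V ∖ V_reg) ≥ n`, that is,
`dim (V ∖ V_reg) + n ≤ dim V`; it holds if `V ∖ V_reg` is empty. -/
def CodimCondition (n : ℕ) (ρ : Representation k G V) : Prop :=
  zariskiDim (polyFun k V) (regularSet ρ)ᶜ + (n : WithBot ℕ∞) ≤
    ((Module.finrank k V : ℕ) : WithBot ℕ∞)

end Codim

/-! ### The two representations -/

section Constructions

variable {k : Type u} [Field k] {G : Type v} [Group G] {V : Type w} [AddCommGroup V] [Module k V]

/-- The representation of `G` on the direct sum `V^{⊕ d}` of `d` copies of `V`. -/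
def powRep (ρ : Representation k G V) (d : ℕ) : Representation k G (Fin d → V) where
  toFun g := LinearMap.pi fun i => ρ g ∘ₗ LinearMap.proj i
  map_one' := by ext; simp
  map_mul' g h := by ext; simp

instance (ρ : Representation k G V) (d : ℕ) [AffineAlgebraicGroup k G] [IsRational ρ] :
    IsRational (powRep ρ d) where
  coeff_mem ℓ v := by
    have h : (fun g => ℓ (powRep ρ d g v)) =
        ∑ i, fun g => (ℓ ∘ₗ LinearMap.single k (fun _ : Fin d => V) i) (ρ g (v i)) := by
      funext g
      rw [Finset.sum_apply]
      conv_lhs => rw [← Finset.univ_sum_single (powRep ρ d g v), map_sum]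
      rfl
    rw [h]
    exact Subalgebra.sum_mem _ fun i _ => IsRational.coeff_mem _ _

/-- The representation of `G × H` on `V ⊗ W`, `(g, h) · (v ⊗ w) = g · v ⊗ h · w`. -/
def boxTensor {H : Type*} [Group H] {W : Type*} [AddCommGroup W] [Module k W]
    (ρ : Representation k G V) (σ : Representation k H W) :
    Representation k (G × H) (V ⊗[k] W) :=
  Representation.tprod (ρ.comp (MonoidHom.fst G H)) (σ.comp (MonoidHom.snd G H))

instance {H : Type*} [Group H] {W : Type*} [AddCommGroup W] [Module k W]
    [AffineAlgebraicGroup k G] [AffineAlgebraicGroup k H] [FiniteDimensional k V]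
    (ρ : Representation k G V) (σ : Representation k H W) [IsRational ρ] [IsRational σ] :
    IsRational (boxTensor ρ σ) where
  coeff_mem ℓ x := by
    induction x with
    | zero => simpa using const_mem (coordRing k (G × H)) 0
    | add x y hx hy =>
      have h : (fun p => ℓ (boxTensor ρ σ p (x + y))) =
          (fun p => ℓ (boxTensor ρ σ p x)) + fun p => ℓ (boxTensor ρ σ p y) := by
        funext p
        simp
      rw [h]
      exact add_mem hx hy
    | tmul v w =>
      let b := Module.finBasis k V
      have h : (fun p : G × H => ℓ (boxTensor ρ σ p (v ⊗ₜ w))) =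
          ∑ i, (fun p : G × H => b.coord i (ρ p.1 v)) *
            fun p : G × H => (ℓ ∘ₗ TensorProduct.mk k V W (b i)) (σ p.2 w) := by
        funext p
        rw [Finset.sum_apply]
        show ℓ (ρ p.1 v ⊗ₜ[k] σ p.2 w) = _
        conv_lhs => rw [← b.sum_repr (ρ p.1 v), TensorProduct.sum_tmul, map_sum]
        refine Finset.sum_congr rfl fun i _ => ?_
        rw [← TensorProduct.smul_tmul', map_smul]
        rfl
      rw [h]
      exact Subalgebra.sum_mem _ fun i _ => mul_mem
        (fst_mem (IsRational.coeff_mem (ρ := ρ) (b.coord i) v))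
        (snd_mem (IsRational.coeff_mem (ρ := σ) _ w))

end Constructions

end

end CodimTwo

open CodimTwo

namespace CodimTwo

universe u v w

/-! ### Krull dimension and derivations -/

section Algebra

/-! A basis of V₂ identifies V₁ ⊗ V₂ with V₁^d compatibly with the action of G₁, so both groups act
on one space. The stabiliser of a point in 𝔤₁ embeds in its stabiliser in 𝔤₁ × 𝔤₂, hence has no
larger dimension (`finrank_lieStabiliser_powRep_le`). In characteristic zero dim G·v = dim 𝔤 − dim
𝔤_v, and stabiliser dimension is minimal generically, so v is regular exactly when dim 𝔤_v is at
most that of a generic stabiliser (`mem_regularSet_iff_finrank_le`). Since the two generic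
stabilisers have equal dimension, every point regular for G₁ × G₂ is regular for G₁. The non-regular
set for G₁ therefore lies in the one for G₁ × G₂, whose codimension is at least 2.

Most of the work is the orbit dimension formula (`orbitDim_eq_finrank`). The coordinate ring of an
orbit closure is a left stable subalgebra B of k[G] generated by matrix coefficients. By Noether
normalisation B is integral over s algebraically independent parameters, and s has to equal the
codimension in 𝔤 of the invariant derivations killing B (`ringKrullDim_eq_finrank`).

If more than s invariant derivations were independent modulo that annihilator, some nonzero
k[G]-combination of them would kill the parameters, hence B by integrality in characteristic zero;
freezing its coefficients at a point would give a forbidden linear relation. Conversely, the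
parameters have dual derivations up to a common denominator h, and at a point where h ≠ 0 these
agree with invariant ones. Both arguments need k[G] to be a domain, which is where connectedness
enters (`isDomain_coordRing`). -/

/-- Lifting a chain of primes along an integral extension, starting at a given prime. -/
theorem exists_ltSeries_of_isIntegral {R : Type*} {S : Type*} [CommRing R] [CommRing S]
    [Algebra R S] [Algebra.IsIntegral R S] (l : LTSeries (PrimeSpectrum R)) :
    ∀ Q : PrimeSpectrum S, Q.comap (algebraMap R S) = l.head →
      ∃ l' : LTSeries (PrimeSpectrum S), l'.head = Q ∧ l'.length = l.length := by
  induction l using RelSeries.inductionOn with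
  | singleton x => exact fun Q _ => ⟨RelSeries.singleton _ Q, rfl, rfl⟩
  | cons p x hx ih =>
    intro Q hQ
    rw [RelSeries.head_cons] at hQ
    have hlt : x < p.head := hx
    obtain ⟨I, hI, hIp, hIc⟩ := Ideal.exists_ideal_over_prime_of_isIntegral
      p.head.asIdeal Q.asIdeal
      (by
        have : (Q.comap (algebraMap R S)).asIdeal ≤ p.head.asIdeal := by rw [hQ]; exact hlt.le
        exact this)
    obtain ⟨l', hl', hlen⟩ := ih ⟨I, hIp⟩ (PrimeSpectrum.ext hIc)
    have hQI : Q < l'.head := by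
      rw [hl']
      refine lt_of_le_of_ne hI ?_
      intro h
      have h2 : Q = ⟨I, hIp⟩ := h
      exact hlt.ne (hQ.symm.trans (h2 ▸ PrimeSpectrum.ext hIc))
    exact ⟨l'.cons Q hQI, by simp, by simp [hlen]⟩

/-- Incomparability makes contraction of primes strictly monotone, which bounds the dimension above;
lying over followed by going up lifts every chain, which bounds it below. -/
theorem ringKrullDim_eq_of_isIntegral {R : Type*} {S : Type*} [CommRing R] [CommRing S]
    [Algebra R S] [Algebra.IsIntegral R S] (hinj : Function.Injective (algebraMap R S)) :
    ringKrullDim S = ringKrullDim R := by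
  refine le_antisymm ?_ ?_
  · refine Order.krullDim_le_of_strictMono (PrimeSpectrum.comap (algebraMap R S)) ?_
    intro p q hpq
    exact Ideal.IsIntegral.comap_lt_comap hpq
  · refine iSup_le fun l => ?_
    obtain ⟨I, -, hI, hIc⟩ := Ideal.exists_ideal_over_prime_of_isIntegral
      l.head.asIdeal (⊥ : Ideal S) (by
        rw [← RingHom.ker_eq_comap_bot, (RingHom.injective_iff_ker_eq_bot _).1 hinj]
        exact bot_le)
    obtain ⟨l', -, hlen⟩ := exists_ltSeries_of_isIntegral l ⟨I, hI⟩ (PrimeSpectrum.ext hIc)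
    rw [← hlen]
    exact le_iSup (fun l : LTSeries (PrimeSpectrum S) => ((l.length : ℕ∞) : WithBot ℕ∞)) l'

/-- In characteristic zero, an `R`-linear derivation of a domain kills the integral elements. -/
theorem derivation_eq_zero_of_isIntegral {R A : Type*} [CommRing R] [CommRing A] [IsDomain A]
    [CharZero A] [Algebra R A] (hinj : Function.Injective (algebraMap R A))
    (E : Derivation R A A) {b : A} (hb : IsIntegral R b) : E b = 0 := by
  classical
  have : IsDomain R := hinj.isDomain (algebraMap R A)
  have hR : CharZero R := (RingHom.charZero_iff hinj).2 inferInstance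
  -- The degree is minimised over all nonzero annihilating polynomials, not only monic ones, so that
  -- the derivative of the minimal one is a competitor.
  have hex : ∃ n, ∃ p : Polynomial R, p ≠ 0 ∧ Polynomial.aeval b p = 0 ∧ p.natDegree = n := by
    obtain ⟨p, hp, h0⟩ := hb
    exact ⟨_, p, hp.ne_zero, h0, rfl⟩
  obtain ⟨p, hp, h0, hn⟩ := Nat.find_spec hex
  have hd : p.natDegree ≠ 0 := by
    intro hd
    rw [Polynomial.eq_C_of_natDegree_eq_zero hd, Polynomial.aeval_C,
      map_eq_zero_iff _ hinj] at h0
    rw [Polynomial.eq_C_of_natDegree_eq_zero hd, h0, map_zero] at hp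
    exact hp rfl
  -- Applying E to p(b) = 0 gives p'(b) · E b = 0, and p'(b) = 0 would contradict minimality, since
  -- p' ≠ 0 in characteristic zero.
  have h1 := E.map_aeval p b
  rw [h0, map_zero, eq_comm, smul_eq_mul, mul_eq_zero] at h1
  refine h1.resolve_left fun h2 => ?_
  refine Nat.find_min hex (m := p.derivative.natDegree) ?_ ⟨p.derivative, ?_, h2, rfl⟩
  · rw [← hn]
    exact Polynomial.natDegree_derivative_lt hd
  · intro h3
    exact hd (Polynomial.derivative_eq_zero.1 h3)

open scoped IntermediateField.algebraAdjoinAdjoin in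
/-- A field is formally étale over the polynomial ring on a transcendence basis, in
characteristic zero. -/
theorem formallyEtale_adjoin_of_isTranscendenceBasis {k L ι : Type*} [Field k] [CharZero k]
    [Field L] [Algebra k L] {x : ι → L} (hx : IsTranscendenceBasis k x) :
    Algebra.FormallyEtale (Algebra.adjoin k (Set.range x)) L := by
  -- The extension is split into a localisation, up to the field generated by the basis, and a
  -- separable algebraic extension.
  have h1 : Algebra.FormallyEtale (Algebra.adjoin k (Set.range x))
      (IntermediateField.adjoin k (Set.range x)) :=
    .of_isLocalization (nonZeroDivisors _)
  have : Algebra.IsAlgebraic (IntermediateField.adjoin k (Set.range x)) L :=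
    hx.isAlgebraic_field
  have h2 : Algebra.FormallyEtale (IntermediateField.adjoin k (Set.range x)) L :=
    Algebra.FormallyEtale.of_isSeparable _ L
  exact .comp _ (IntermediateField.adjoin k (Set.range x)) _

/-- Partial derivatives with respect to a transcendence basis. -/
theorem exists_derivation_of_isTranscendenceBasis {k L ι : Type*} [Field k] [CharZero k]
    [Field L] [Algebra k L] {x : ι → L} (hx : IsTranscendenceBasis k x) (j : ι) [DecidableEq ι] :
    ∃ δ : Derivation k L L, ∀ i, δ (x i) = if i = j then 1 else 0 := by
  have := formallyEtale_adjoin_of_isTranscendenceBasis hx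
  let A := Algebra.adjoin k (Set.range x)
  let e : MvPolynomial ι k ≃ₐ[k] A := hx.1.aevalEquiv
  let d : Derivation k A L := Derivation.mk'
    ((Algebra.linearMap A L).restrictScalars k ∘ₗ e.toLinearMap ∘ₗ
      (MvPolynomial.pderiv j : Derivation k (MvPolynomial ι k) (MvPolynomial ι k)).toLinearMap ∘ₗ
      e.symm.toLinearMap) (by
        intro a b
        simp [Algebra.smul_def])
  -- Formal étaleness gives Ω[L⁄k] ≃ L ⊗ Ω[A⁄k], so the partial derivative d on A extends to L.
  let Φ : Ω[L⁄k] →ₗ[L] L := (d.liftKaehlerDifferential.liftBaseChange L) ∘ₗ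
    (KaehlerDifferential.tensorKaehlerEquivOfFormallyEtale k A L).symm.toLinearMap
  refine ⟨Φ.compDer (KaehlerDifferential.D k L), fun i => ?_⟩
  have hxi : x i = algebraMap A L (e (MvPolynomial.X i)) := by
    simp [e, A]
  rw [hxi]
  have : d (e (MvPolynomial.X i)) = if i = j then 1 else 0 := by
    show algebraMap A L (e (MvPolynomial.pderiv j (e.symm (e (MvPolynomial.X i))))) = _
    rw [e.symm_apply_apply, MvPolynomial.pderiv_X]
    by_cases h : i = j
    · subst h; simp
    · simp [h]
  rw [← this]
  show d.liftKaehlerDifferential.liftBaseChange L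
    ((KaehlerDifferential.tensorKaehlerEquivOfFormallyEtale k A L).symm
      (KaehlerDifferential.D k L (algebraMap A L (e (MvPolynomial.X i))))) = _
  rw [KaehlerDifferential.tensorKaehlerEquivOfFormallyEtale_symm_D_algebraMap]
  simp

/-- Algebraically independent elements of a field of characteristic zero have dual derivations. -/
theorem exists_dual_derivation {k L ι : Type*} [Field k] [CharZero k] [Field L] [Algebra k L]
    [DecidableEq ι] {z : ι → L} (hz : AlgebraicIndependent k z) (j : ι) :
    ∃ δ : Derivation k L L, ∀ i, δ (z i) = if i = j then 1 else 0 := by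
  classical
  obtain ⟨t, ht, hb⟩ := exists_isTranscendenceBasis_superset hz.to_subtype_range
  obtain ⟨δ, hδ⟩ := exists_derivation_of_isTranscendenceBasis hb ⟨z j, ht ⟨j, rfl⟩⟩
  refine ⟨δ, fun i => ?_⟩
  have := hδ ⟨z i, ht ⟨i, rfl⟩⟩
  simpa [hz.injective.eq_iff] using this

/-- Algebraically independent elements of a finitely generated domain of characteristic zero have
derivations dual to them up to a common denominator. -/
theorem exists_dual_derivation_of_fg {k A : Type*} [Field k] [CharZero k] [CommRing A] [IsDomain A]
    [Algebra k A] [Algebra.FiniteType k A] {s : ℕ} {z : Fin s → A}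
    (hz : AlgebraicIndependent k z) :
    ∃ (h : A) (δ : Fin s → Derivation k A A), h ≠ 0 ∧
      ∀ j i, δ j (z i) = if i = j then h else 0 := by
  classical
  let L := FractionRing A
  have hinj : Function.Injective (algebraMap A L) := IsFractionRing.injective A L
  have hz' : AlgebraicIndependent k (algebraMap A L ∘ z) :=
    hz.map' (f := IsScalarTower.toAlgHom k A L) hinj
  choose δ hδ using fun j => exists_dual_derivation hz' j
  obtain ⟨S, hS⟩ := Algebra.FiniteType.out (R := k) (A := A)
  -- One denominator for the finitely many values δ j a with a a generator; the Leibniz rule then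
  -- makes h · δ j preserve all of A.
  obtain ⟨h, hh⟩ := IsLocalization.exist_integer_multiples_of_finset (nonZeroDivisors A)
    ((Finset.univ ×ˢ S).image fun p : Fin s × A => δ p.1 (algebraMap A L p.2))
  have key : ∀ j a, ∃ b : A, algebraMap A L b = algebraMap A L h * δ j (algebraMap A L a) := by
    intro j a
    have ha : a ∈ Algebra.adjoin k (S : Set A) := by rw [hS]; trivial
    induction ha using Algebra.adjoin_induction with
    | mem x hx =>
      obtain ⟨b, hb⟩ := hh _ (Finset.mem_image_of_mem (a := (j, x)) _
        (Finset.mem_product.2 ⟨Finset.mem_univ j, Finset.mem_coe.1 hx⟩))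
      exact ⟨b, by rw [hb]; exact Algebra.smul_def _ _⟩
    | algebraMap r =>
      exact ⟨0, by rw [← IsScalarTower.algebraMap_apply k A L]; simp⟩
    | add x y _ _ hx hy =>
      obtain ⟨b, hb⟩ := hx
      obtain ⟨c, hc⟩ := hy
      exact ⟨b + c, by simp [hb, hc, mul_add]⟩
    | mul x y _ _ hx hy =>
      obtain ⟨b, hb⟩ := hx
      obtain ⟨c, hc⟩ := hy
      refine ⟨x * c + y * b, ?_⟩
      simp only [map_add, map_mul, Derivation.leibniz, smul_eq_mul, hb, hc]
      ring
  choose c hc using key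
  refine ⟨h, fun j => Derivation.mk'
    { toFun := c j
      map_add' := fun x y => hinj (by simp [hc, mul_add])
      map_smul' := fun r x => hinj (by
        have e : ∀ y : A, algebraMap A L (r • y) = r • algebraMap A L y := fun y =>
          map_smul (IsScalarTower.toAlgHom k A L) r y
        rw [RingHom.id_apply, hc, e, e, hc, Derivation.map_smul, mul_smul_comm]) }
    (fun a b => hinj (by
      show algebraMap A L (c j (a * b)) = algebraMap A L (a * c j b + b * c j a)
      simp only [map_add, map_mul, Derivation.leibniz, smul_eq_mul, hc]
      ring)), nonZeroDivisors.ne_zero h.2, fun j i => hinj ?_⟩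
  show algebraMap A L (c j (z i)) = _
  rw [hc]
  have := hδ j i
  rw [Function.comp_apply] at this
  rw [this]
  split_ifs <;> simp

end Algebra

/-! ### Irreducibility of connected groups -/

section Irreducible

/-- A connected space in which every point has an irreducible open neighbourhood is
irreducible. -/
theorem preirreducibleSpace_of_locally {X : Type*} [TopologicalSpace X] [ConnectedSpace X]
    (h : ∀ x : X, ∃ U : Set X, IsOpen U ∧ x ∈ U ∧ IsPreirreducible U) : PreirreducibleSpace X := by
  obtain ⟨x₀⟩ := (inferInstance : Nonempty X)
  have hopen : IsOpen (irreducibleComponent x₀) := by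
    refine isOpen_iff_forall_mem_open.2 fun x hx => ?_
    obtain ⟨U, hU, hxU, hUi⟩ := h x
    refine ⟨U, ?_, hU, hxU⟩
    -- The part of the component inside U is dense in it. The closure of U is thus an irreducible
    -- set containing the component, and maximality gives equality.
    have h1 : irreducibleComponent x₀ ⊆ closure U :=
      (subset_closure_inter_of_isPreirreducible_of_isOpen
        isIrreducible_irreducibleComponent.isPreirreducible hU ⟨x, hx, hxU⟩).trans
        (closure_mono Set.inter_subset_right)
    have h2 : closure U = irreducibleComponent x₀ :=
      eq_irreducibleComponent hUi.closure h1
    exact h2 ▸ subset_closure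
  have huniv : irreducibleComponent x₀ = Set.univ :=
    IsClopen.eq_univ ⟨isClosed_irreducibleComponent, hopen⟩ ⟨x₀, mem_irreducibleComponent⟩
  exact ⟨huniv ▸ isIrreducible_irreducibleComponent.isPreirreducible⟩

/-- In a nonempty Noetherian space some point has an irreducible open neighbourhood. -/
theorem exists_open_preirreducible {X : Type*} [TopologicalSpace X]
    [TopologicalSpace.NoetherianSpace X] [Nonempty X] :
    ∃ (x : X) (U : Set X), IsOpen U ∧ x ∈ U ∧ IsPreirreducible U := by
  obtain ⟨x₀⟩ := (inferInstance : Nonempty X)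
  obtain ⟨o, ho, ⟨x, hx⟩, hle⟩ :=
    TopologicalSpace.NoetherianSpace.exists_isOpen_nonempty_subset_irreducibleComponent _
      (irreducibleComponent_mem_irreducibleComponents x₀)
  exact ⟨x, o, ho, hx, isIrreducible_irreducibleComponent.isPreirreducible.open_subset ho hle⟩

variable {k : Type u} [Field k]

theorem isOpen_zariski {X : Type v} {A : Subalgebra k (X → k)} {f : X → k} (hf : f ∈ A) :
    @IsOpen X (zariski A) {x | f x ≠ 0} :=
  TopologicalSpace.isOpen_generateFrom_of_mem ⟨f, hf, rfl⟩

/-- A set with a Noetherian algebra of functions is a Noetherian space. -/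
theorem noetherianSpace_zariski {X : Type v} (A : Subalgebra k (X → k)) [IsNoetherianRing A] :
    @TopologicalSpace.NoetherianSpace X (zariski A) := by
  let := zariski A
  let ev : X → A →ₐ[k] k := fun x => (Pi.evalAlgHom k (fun _ : X => k) x).comp A.val
  let i : X → PrimeSpectrum A := fun x =>
    ⟨RingHom.ker (ev x), RingHom.ker_isPrime (ev x)⟩
  -- Sending x to the kernel of evaluation at x induces the Zariski topology from the Noetherian
  -- space `PrimeSpectrum A`.
  refine Topology.IsInducing.noetherianSpace (i := i) ⟨?_⟩
  show zariski A = _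
  rw [PrimeSpectrum.isTopologicalBasis_basic_opens.eq_generateFrom, induced_generateFrom_eq]
  refine congrArg _ (Set.ext fun U => ⟨?_, ?_⟩)
  · rintro ⟨f, hf, rfl⟩
    exact ⟨_, ⟨⟨f, hf⟩, rfl⟩, rfl⟩
  · rintro ⟨_, ⟨f, rfl⟩, rfl⟩
    exact ⟨f.1, f.2, rfl⟩

variable {G : Type v} [Group G] [AffineAlgebraicGroup k G]

instance : Algebra.FiniteType k (coordRing k G) :=
  (Subalgebra.fg_iff_finiteType _).1 AffineAlgebraicGroup.fg

theorem continuous_mul_left_zariski (g : G) :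
    @Continuous G G (zariski (coordRing k G)) (zariski (coordRing k G)) (fun x => g * x) := by
  let := zariski (coordRing k G)
  refine continuous_generateFrom_iff.2 ?_
  rintro _ ⟨f, hf, rfl⟩
  exact isOpen_zariski (left_mem g hf)

/-- The coordinate ring of a connected affine algebraic group is a domain. -/
theorem isDomain_coordRing (hG : IsZariskiConnected k G) : IsDomain (coordRing k G) := by
  let : TopologicalSpace G := zariski (coordRing k G)
  have : ConnectedSpace G := hG
  have : IsNoetherianRing (coordRing k G) := Algebra.FiniteType.isNoetherianRing k _
  have : TopologicalSpace.NoetherianSpace G := noetherianSpace_zariski (coordRing k G)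
  obtain ⟨x, U, hU, hxU, hUi⟩ := exists_open_preirreducible (X := G)
  have : PreirreducibleSpace G := by
    refine preirreducibleSpace_of_locally fun y => ?_
    -- Homogeneity: left translation by y x⁻¹ carries the irreducible neighbourhood of x to one of
    -- y.
    refine ⟨(fun z => y * x⁻¹ * z) '' U, ?_, ⟨x, hxU, by simp⟩,
      hUi.image _ (continuous_mul_left_zariski (k := k) _).continuousOn⟩
    have : (fun z => y * x⁻¹ * z) '' U = (fun z => (y * x⁻¹)⁻¹ * z) ⁻¹' U := by
      ext z
      constructor
      · rintro ⟨u, hu, rfl⟩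
        simpa [mul_assoc] using hu
      · intro hz
        exact ⟨_, hz, by simp [mul_assoc]⟩
    rw [this]
    exact hU.preimage (continuous_mul_left_zariski (k := k) _)
  have : NoZeroDivisors (coordRing k G) := by
    refine ⟨fun {a b} hab => ?_⟩
    by_contra! hne
    have hex : ∀ c : coordRing k G, c ≠ 0 → ∃ z, c.1 z ≠ 0 := fun c hc => by
      by_contra! h
      exact hc (coordRing_ext h)
    obtain ⟨z, -, hz, hz'⟩ := PreirreducibleSpace.isPreirreducible_univ _ _
      (isOpen_zariski a.2) (isOpen_zariski b.2)
      (by obtain ⟨z, hz⟩ := hex a hne.1; exact ⟨z, trivial, hz⟩)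
      (by obtain ⟨z, hz⟩ := hex b hne.2; exact ⟨z, trivial, hz⟩)
    have : a.1 z * b.1 z = 0 := congrFun (congrArg Subtype.val hab) z
    exact (mul_ne_zero hz hz') this
  have : Nontrivial (coordRing k G) :=
    ⟨0, 1, fun h => zero_ne_one (congrFun (congrArg Subtype.val h) (1 : G))⟩
  exact NoZeroDivisors.to_isDomain _

theorem slice_left_mem {X : Type*} {Y : Type*} {A : Subalgebra k (X → k)} {B : Subalgebra k (Y → k)}
    {F : X × Y → k} (hF : F ∈ prodAlg A B) (x : X) : (fun y => F (x, y)) ∈ B :=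
  pullback_mem_of_prodAlg (fun y => (x, y)) (fun a _ => const_mem _ (a x)) (fun _ hb => hb) hF

theorem slice_right_mem {X : Type*} {Y : Type*} {A : Subalgebra k (X → k)}
    {B : Subalgebra k (Y → k)} {F : X × Y → k} (hF : F ∈ prodAlg A B) (y : Y) :
    (fun x => F (x, y)) ∈ A :=
  pullback_mem_of_prodAlg (fun x => (x, y)) (fun _ ha => ha) (fun b _ => const_mem _ (b y)) hF

theorem exists_ne_zero_and_ne_zero {Z : Type*} {C : Subalgebra k (Z → k)} [IsDomain C]
    {c d : Z → k} (hc : c ∈ C) (hd : d ∈ C) (hc0 : ∃ z, c z ≠ 0) (hd0 : ∃ z, d z ≠ 0) :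
    ∃ z, c z ≠ 0 ∧ d z ≠ 0 := by
  obtain ⟨z, hz⟩ := hc0
  obtain ⟨w, hw⟩ := hd0
  by_contra! h
  have : (⟨c, hc⟩ : C) * ⟨d, hd⟩ = 0 := Subtype.ext (funext fun z => by
    show c z * d z = 0
    by_cases h0 : c z = 0
    · rw [h0, zero_mul]
    · rw [h z h0, mul_zero])
  rcases mul_eq_zero.1 this with h0 | h0
  · exact hz (congrFun (congrArg Subtype.val h0) z)
  · exact hw (congrFun (congrArg Subtype.val h0) w)

/-- A product of integral algebras of functions is integral. -/
theorem isDomain_prodAlg {X : Type*} {Y : Type*} {A : Subalgebra k (X → k)}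
    {B : Subalgebra k (Y → k)} [IsDomain A] [IsDomain B] : IsDomain (prodAlg A B) := by
  have : NoZeroDivisors (prodAlg A B) := by
    refine ⟨fun {a b} hab => ?_⟩
    by_contra! hne
    have hex : ∀ c : prodAlg A B, c ≠ 0 → ∃ z, c.1 z ≠ 0 := fun c hc => by
      by_contra! h
      exact hc (Subtype.ext (funext h))
    obtain ⟨⟨x, y⟩, h1⟩ := hex a hne.1
    obtain ⟨⟨x', y'⟩, h2⟩ := hex b hne.2
    -- The two points of non-vanishing are merged one coordinate at a time: first a common z in X,
    -- then a common w in Y.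
    obtain ⟨z, hz, hz'⟩ := exists_ne_zero_and_ne_zero (slice_right_mem a.2 y)
      (slice_right_mem b.2 y') ⟨x, h1⟩ ⟨x', h2⟩
    obtain ⟨w, hw, hw'⟩ := exists_ne_zero_and_ne_zero (slice_left_mem a.2 z)
      (slice_left_mem b.2 z) ⟨y, hz⟩ ⟨y', hz'⟩
    have : a.1 (z, w) * b.1 (z, w) = 0 := congrFun (congrArg Subtype.val hab) (z, w)
    exact mul_ne_zero hw hw' this
  have : Nontrivial (prodAlg A B) := by
    obtain ⟨a, ha⟩ := exists_ne (0 : A)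
    obtain ⟨b, hb⟩ := exists_ne (0 : B)
    obtain ⟨x, -⟩ : ∃ x, a.1 x ≠ 0 := by
      by_contra! h
      exact ha (Subtype.ext (funext h))
    obtain ⟨y, -⟩ : ∃ y, b.1 y ≠ 0 := by
      by_contra! h
      exact hb (Subtype.ext (funext h))
    exact ⟨0, 1, fun h => zero_ne_one (congrFun (congrArg Subtype.val h) (x, y))⟩
  exact NoZeroDivisors.to_isDomain _

end Irreducible

/-! ### The Lie algebra and point derivations -/

section LieAlgebra

variable {k : Type u} [Field k]

/-- Applying a linear form to the slices of a regular function on a product gives a regular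
function. -/
theorem exists_apply_slice {X : Type*} {Y : Type*} {A : Subalgebra k (X → k)}
    {B : Subalgebra k (Y → k)} (d : B →ₗ[k] k) {F : X × Y → k} (hF : F ∈ prodAlg A B) :
    ∃ a ∈ A, ∀ x, d ⟨fun y => F (x, y), slice_left_mem hF x⟩ = a x := by
  -- Membership of the slices is made part of the claim so that the induction over sums of products
  -- carries it along.
  suffices h : (∀ x, (fun y => F (x, y)) ∈ B) ∧
      ∃ a ∈ A, ∀ x (hx : (fun y => F (x, y)) ∈ B), d ⟨_, hx⟩ = a x from
    h.2.imp fun a ha => ⟨ha.1, fun x => ha.2 x _⟩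
  have hF' : F ∈ Subalgebra.toSubmodule (A.map (pullback k Prod.fst)) *
      Subalgebra.toSubmodule (B.map (pullback k Prod.snd)) := by
    rw [Subalgebra.mul_toSubmodule]
    exact hF
  clear hF
  induction hF' using Submodule.mul_induction_on' with
  | mem_mul_mem f hf g hg =>
    obtain ⟨a, ha, rfl⟩ := hf
    obtain ⟨b, hb, rfl⟩ := hg
    have key : ∀ x, (fun y => ((fun p : X × Y => a p.1) * fun p : X × Y => b p.2) (x, y)) =
        a x • b := fun x => rfl
    refine ⟨fun x => key x ▸ B.smul_mem hb _, d ⟨b, hb⟩ • a, A.smul_mem ha _, ?_⟩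
    intro x hx
    have : (⟨_, hx⟩ : B) = a x • ⟨b, hb⟩ := rfl
    rw [this, map_smul, smul_eq_mul, Pi.smul_apply, smul_eq_mul, mul_comm]
  | add f hf g hg ihf ihg =>
    obtain ⟨h1, a, ha, hda⟩ := ihf
    obtain ⟨h2, b, hb, hdb⟩ := ihg
    refine ⟨fun x => B.add_mem (h1 x) (h2 x), a + b, A.add_mem ha hb, fun x hx => ?_⟩
    have : (⟨_, hx⟩ : B) = ⟨_, h1 x⟩ + ⟨_, h2 x⟩ := rfl
    rw [this, map_add, hda, hdb, Pi.add_apply]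

variable {G : Type v} [Group G] [AffineAlgebraicGroup k G]

theorem lieAlg_apply (D : LieAlg k G) (f : coordRing k G) (g : G) :
    (D.1 f).1 g = (D.1 (leftTranslate k g f)).1 1 := by
  rw [D.2 g f, leftTranslate_apply, mul_one]

/-- Left invariance recovers D f at every point from values of D at the identity, so D is a tangent
vector there. -/
theorem lieAlg_ext {D E : LieAlg k G} (h : ∀ f, (D.1 f).1 1 = (E.1 f).1 1) : D = E :=
  Subtype.ext (Derivation.ext fun f => coordRing_ext fun g => by
    rw [lieAlg_apply D, lieAlg_apply E, h])

/-- The left invariant derivation with a given value at the identity. -/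
noncomputable def lieOfPoint (d : coordRing k G →ₗ[k] k)
    (hd : ∀ a b : coordRing k G, d (a * b) = a.1 1 * d b + b.1 1 * d a) : LieAlg k G :=
  ⟨Derivation.mk'
    { toFun := fun f => ⟨fun x => d (leftTranslate k x f), by
        obtain ⟨a, ha, h⟩ := exists_apply_slice d (AffineAlgebraicGroup.mul_regular f.1 f.2)
        exact (funext h : (fun x => d (leftTranslate k x f)) = a) ▸ ha⟩
      map_add' := fun a b => coordRing_ext fun x => by
        show d (leftTranslate k x (a + b)) =
          d (leftTranslate k x a) + d (leftTranslate k x b)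
        rw [map_add, map_add]
      map_smul' := fun c a => coordRing_ext fun x => by
        show d (leftTranslate k x (c • a)) = c * d (leftTranslate k x a)
        rw [map_smul, map_smul, smul_eq_mul] }
    (fun a b => coordRing_ext fun x => by
      show d (leftTranslate k x (a * b)) =
        a.1 x * d (leftTranslate k x b) + b.1 x * d (leftTranslate k x a)
      rw [map_mul, hd]
      simp), fun g f => coordRing_ext fun x => by
    show d (leftTranslate k x (leftTranslate k g f)) = d (leftTranslate k (g * x) f)
    congr 1
    exact coordRing_ext fun y => by simp [mul_assoc]⟩

theorem lieOfPoint_apply (d : coordRing k G →ₗ[k] k)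
    (hd : ∀ a b : coordRing k G, d (a * b) = a.1 1 * d b + b.1 1 * d a) (f : coordRing k G)
    (x : G) : ((lieOfPoint d hd).1 f).1 x = d (leftTranslate k x f) := rfl

theorem lieOfPoint_apply_one (d : coordRing k G →ₗ[k] k)
    (hd : ∀ a b : coordRing k G, d (a * b) = a.1 1 * d b + b.1 1 * d a) (f : coordRing k G) :
    ((lieOfPoint d hd).1 f).1 1 = d f := by
  rw [lieOfPoint_apply]
  congr 1
  exact coordRing_ext fun y => by simp

/-- Evaluation of `D f` at `g`, as a linear form in `D`. -/
def lieEval (g : G) (f : coordRing k G) : LieAlg k G →ₗ[k] k where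
  toFun D := (D.1 f).1 g
  map_add' _ _ := rfl
  map_smul' _ _ := rfl

/-- By the Leibniz rule, a point derivation at the identity is determined by its values on finitely
many generators of k[G]. -/
instance : FiniteDimensional k (LieAlg k G) := by
  obtain ⟨S, hS⟩ := Algebra.FiniteType.out (R := k) (A := coordRing k G)
  let Φ : LieAlg k G →ₗ[k] (S → k) := LinearMap.pi fun s => lieEval 1 s.1
  refine FiniteDimensional.of_injective Φ ?_
  rw [← LinearMap.ker_eq_bot, LinearMap.ker_eq_bot']
  intro D hD
  refine lieAlg_ext fun f => ?_
  have hf : f ∈ Algebra.adjoin k (S : Set (coordRing k G)) := by rw [hS]; trivial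
  show (D.1 f).1 1 = 0
  induction hf using Algebra.adjoin_induction with
  | mem x hx => exact congrFun hD ⟨x, hx⟩
  | algebraMap r => rw [Derivation.map_algebraMap]; rfl
  | add x y _ _ hx hy =>
    rw [map_add]
    show (D.1 x).1 1 + (D.1 y).1 1 = 0
    rw [hx, hy, add_zero]
  | mul x y _ _ hx hy =>
    rw [Derivation.leibniz]
    show x.1 1 * (D.1 y).1 1 + y.1 1 * (D.1 x).1 1 = 0
    rw [hx, hy, mul_zero, mul_zero, add_zero]

/-- The value at `g` of a derivation of `k[G]` agrees with that of a left invariant one. -/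
theorem exists_lieAlg_eq (δ : Derivation k (coordRing k G) (coordRing k G)) (g : G) :
    ∃ D : LieAlg k G, ∀ f, (D.1 f).1 g = (δ f).1 g := by
  -- The tangent vector of δ at g, carried to the identity by left translation.
  let d : coordRing k G →ₗ[k] k :=
    { toFun := fun f => (δ (leftTranslate k g⁻¹ f)).1 g
      map_add' := fun a b => by rw [map_add, map_add]; rfl
      map_smul' := fun c a => by rw [map_smul, Derivation.map_smul]; rfl }
  refine ⟨lieOfPoint d fun a b => ?_, fun f => ?_⟩
  · show (δ (leftTranslate k g⁻¹ (a * b))).1 g = _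
    rw [map_mul, Derivation.leibniz]
    show a.1 (g⁻¹ * g) * _ + b.1 (g⁻¹ * g) * _ = _
    rw [inv_mul_cancel]
    rfl
  · rw [lieOfPoint_apply]
    show (δ (leftTranslate k g⁻¹ (leftTranslate k g f))).1 g = _
    have : leftTranslate k g⁻¹ (leftTranslate k g f) = f := coordRing_ext fun y => by simp
    rw [this]

/-- The left invariant derivations that kill a subalgebra. -/
def lieAnnihilator (B : Subalgebra k (coordRing k G)) : Submodule k (LieAlg k G) where
  carrier := {D | ∀ b ∈ B, D.1 b = 0}
  add_mem' := fun {D E} hD hE b hb => by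
    show D.1 b + E.1 b = 0
    rw [hD b hb, hE b hb, add_zero]
  zero_mem' := fun _ _ => rfl
  smul_mem' := fun c D hD b hb => by
    show c • D.1 b = 0
    rw [hD b hb, smul_zero]

/-- In characteristic zero, a derivation that kills the generators of a polynomial algebra kills the
elements integral over it. -/
theorem derivation_eq_zero_of_isIntegralElem {A σ : Type*} [CharZero k] [CommRing A] [IsDomain A]
    [Algebra k A] (E : Derivation k A A) (φ : MvPolynomial σ k →ₐ[k] A)
    (hE : ∀ j, E (φ (MvPolynomial.X j)) = 0) {b : A}
    (hb : RingHom.IsIntegralElem (φ : MvPolynomial σ k →+* A) b) : E b = 0 := by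
  -- Killing the image of φ makes E linear over `φ.range`, so the result on integral elements
  -- applies to it.
  have hR : ∀ r : φ.range, E (algebraMap φ.range A r) = 0 := by
    rintro ⟨_, ⟨p, rfl⟩⟩
    show E (φ p) = 0
    induction p using MvPolynomial.induction_on with
    | C r => rw [← MvPolynomial.algebraMap_eq, AlgHom.commutes, Derivation.map_algebraMap]
    | add p q hp hq => rw [map_add, map_add, hp, hq, add_zero]
    | mul_X p j hp => rw [map_mul, Derivation.leibniz, hp, hE, smul_zero, smul_zero, add_zero]
  let E' : Derivation φ.range A A := Derivation.mk'
    { toFun := E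
      map_add' := map_add E
      map_smul' := fun r f => by
        rw [Algebra.smul_def, Derivation.leibniz, hR r, smul_zero, add_zero, RingHom.id_apply,
          algebraMap_smul] }
    (fun a b => E.leibniz a b)
  have hchar : CharZero A := (RingHom.charZero_iff (algebraMap k A).injective).1 inferInstance
  refine derivation_eq_zero_of_isIntegral (R := φ.range) Subtype.val_injective E' ?_
  obtain ⟨p, hp, h0⟩ := hb
  refine ⟨p.map φ.rangeRestrict.toRingHom, hp.map _, ?_⟩
  rw [Polynomial.eval₂_map, ← h0]
  rfl

/-- An `A`-linear combination of derivations of `A` that kills fewer given elements than it has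
terms. -/
theorem exists_sum_mul_derivation_eq_zero {A : Type*} [CommRing A] [IsDomain A] [Algebra k A]
    {m s : ℕ} (hlt : s < m) (D : Fin m → Derivation k A A) (z : Fin s → A) :
    ∃ a : Fin m → A, a ≠ 0 ∧ ∀ j, ∑ i, a i * D i (z j) = 0 := by
  let T : (Fin m → A) →ₗ[A] (Fin s → A) :=
    LinearMap.pi fun j => ∑ i, D i (z j) • LinearMap.proj i
  -- A linear system with fewer equations than unknowns has a nonzero solution.
  have hT : ¬ Function.Injective T := fun h => hlt.not_ge (le_of_fin_injective _ T h)
  rw [← LinearMap.ker_eq_bot, LinearMap.ker_eq_bot'] at hT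
  push Not at hT
  obtain ⟨a, ha, ha0⟩ := hT
  refine ⟨a, ha0, fun j => ?_⟩
  have := congrFun ha j
  simpa [T, mul_comm] using this

/-- A combination `∑ aᵢ Dᵢ` of left invariant derivations that kills a left stable subalgebra does
so with the coefficients frozen at any point. -/
theorem sum_smul_mem_lieAnnihilator {B : Subalgebra k (coordRing k G)}
    (hB : ∀ g, ∀ b ∈ B, leftTranslate k g b ∈ B) {m : ℕ} (D : Fin m → LieAlg k G)
    (a : Fin m → coordRing k G) (h : ∀ b ∈ B, ∑ i, a i * (D i).1 b = 0) (g : G) :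
    ∑ i, (a i).1 g • D i ∈ lieAnnihilator B := by
  intro b hb
  refine coordRing_ext fun x => ?_
  -- The relation is applied to b translated by x g⁻¹ and evaluated at g: invariance then turns the
  -- derivatives at g into derivatives of b at x, while the coefficients stay at g.
  have h1 := congrArg ((Pi.evalAlgHom k (fun _ : G => k) g).comp (coordRing k G).val)
    (h _ (hB (x * g⁻¹) b hb))
  rw [map_sum, map_zero] at h1
  show lieEval x b (∑ i, (a i).1 g • D i) = 0
  rw [map_sum, ← h1]
  refine Finset.sum_congr rfl fun i _ => ?_
  rw [map_smul, map_mul]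
  show (a i).1 g * ((D i).1 b).1 x =
    (a i).1 g * ((D i).1 (leftTranslate k (x * g⁻¹) b)).1 g
  rw [(D i).2, leftTranslate_apply, inv_mul_cancel_right]

/-- Upper bound: in characteristic zero there are at most `s` invariant derivations, linearly
independent modulo those that kill `B`, if `B` is integral over `s` elements. -/
theorem finrank_le_of_isIntegral [CharZero k] [IsDomain (coordRing k G)]
    {B : Subalgebra k (coordRing k G)} (hB : ∀ g, ∀ b ∈ B, leftTranslate k g b ∈ B) {s : ℕ}
    (φ : MvPolynomial (Fin s) k →ₐ[k] coordRing k G)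
    (hφ : ∀ b ∈ B, RingHom.IsIntegralElem (φ : MvPolynomial (Fin s) k →+* coordRing k G) b) :
    Module.finrank k (LieAlg k G ⧸ lieAnnihilator B) ≤ s := by
  by_contra! hlt
  let b := Module.finBasis k (LieAlg k G ⧸ lieAnnihilator B)
  choose D hD using fun i => Submodule.mkQ_surjective (lieAnnihilator B) (b i)
  obtain ⟨a, ha0, ha⟩ := exists_sum_mul_derivation_eq_zero hlt (fun i => (D i).1)
    fun j => φ (MvPolynomial.X j)
  let E : Derivation k (coordRing k G) (coordRing k G) := ∑ i, a i • (D i).1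
  have hE : ∀ f, E f = ∑ i, a i * (D i).1 f := fun f => by
    show Derivation.coeFnAddMonoidHom E f = _
    rw [map_sum, Finset.sum_apply]
    rfl
  have hEB : ∀ b ∈ B, ∑ i, a i * (D i).1 b = 0 := fun b hb => by
    rw [← hE]
    exact derivation_eq_zero_of_isIntegralElem E φ (fun j => (hE _).trans (ha j)) (hφ b hb)
  -- A point where some coefficient is nonzero keeps the frozen relation nontrivial, against
  -- independence of the basis.
  obtain ⟨i, hi⟩ := Function.ne_iff.1 ha0
  obtain ⟨g, hg⟩ : ∃ g, (a i).1 g ≠ 0 := by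
    by_contra! h
    exact hi (coordRing_ext h)
  have hz : ∑ i, (a i).1 g • b i = 0 := by
    have h0 : (lieAnnihilator B).mkQ (∑ i, (a i).1 g • D i) = 0 :=
      (Submodule.Quotient.mk_eq_zero _).2 (sum_smul_mem_lieAnnihilator hB D a hEB g)
    rw [map_sum] at h0
    refine Eq.trans (Finset.sum_congr rfl fun i _ => ?_) h0
    rw [map_smul, hD]
  exact hg (Fintype.linearIndependent_iff.1 b.linearIndependent _ hz i)

/-- Lower bound: algebraically independent elements of `B` give invariant derivations that are
linearly independent modulo those that kill `B`. -/
theorem le_finrank_of_algebraicIndependent [CharZero k] [IsDomain (coordRing k G)]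
    {B : Subalgebra k (coordRing k G)} {s : ℕ} {z : Fin s → coordRing k G} (hzB : ∀ i, z i ∈ B)
    (hz : AlgebraicIndependent k z) :
    s ≤ Module.finrank k (LieAlg k G ⧸ lieAnnihilator B) := by
  obtain ⟨h, δ, h0, hδ⟩ := exists_dual_derivation_of_fg hz
  obtain ⟨g, hg⟩ : ∃ g, h.1 g ≠ 0 := by
    by_contra! hh
    exact h0 (coordRing_ext hh)
  -- At g the matrix of the D j on the z i is h(g) times the identity, hence invertible.
  choose D hD using fun j => exists_lieAlg_eq (δ j) g
  let Ψ : LieAlg k G →ₗ[k] (Fin s → k) := LinearMap.pi fun i => lieEval g (z i)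
  have hΨ : ∀ E ∈ lieAnnihilator B, Ψ E = 0 := fun E hE => funext fun i =>
    congrFun (congrArg Subtype.val (hE _ (hzB i))) g
  let Ψ' := (lieAnnihilator B).liftQ Ψ hΨ
  have hsurj : Function.Surjective Ψ' := by
    intro c
    refine ⟨(lieAnnihilator B).mkQ (∑ j, (c j * (h.1 g)⁻¹) • D j), ?_⟩
    show Ψ (∑ j, (c j * (h.1 g)⁻¹) • D j) = c
    funext i
    have h1 : ∀ j, lieEval g (z i) (D j) = if i = j then h.1 g else 0 := fun j => by
      show ((D j).1 (z i)).1 g = _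
      rw [hD, hδ]
      split_ifs <;> rfl
    show lieEval g (z i) _ = c i
    rw [map_sum]
    simp [h1, hg]
  have := LinearMap.finrank_le_finrank_of_surjective hsurj
  simpa using this

/-- The dimension of a left stable finitely generated subalgebra of `k[G]`. -/
theorem ringKrullDim_eq_finrank [CharZero k] [IsDomain (coordRing k G)]
    {B : Subalgebra k (coordRing k G)} (hfg : B.FG)
    (hB : ∀ g, ∀ b ∈ B, leftTranslate k g b ∈ B) :
    ringKrullDim B = (Module.finrank k (LieAlg k G ⧸ lieAnnihilator B) : ℕ) := by
  have := (Subalgebra.fg_iff_finiteType B).1 hfg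
  -- Noether normalisation; s is compared with both sides of the equality.
  obtain ⟨s, φ, hinj, hint⟩ := exists_integral_inj_algHom_of_fg k B
  have hdim : ringKrullDim B = (s : ℕ) := by
    let := (φ : MvPolynomial (Fin s) k →+* B).toAlgebra
    have : Algebra.IsIntegral (MvPolynomial (Fin s) k) B := ⟨hint⟩
    rw [ringKrullDim_eq_of_isIntegral (R := MvPolynomial (Fin s) k) (S := B) hinj,
      MvPolynomial.ringKrullDim_of_isNoetherianRing, ringKrullDim_eq_zero_of_field]
    simp
  rw [hdim]
  congr 2
  refine le_antisymm ?_ (finrank_le_of_isIntegral hB (B.val.comp φ) fun b hb => ?_)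
  swap
  · obtain ⟨p, hp, h0⟩ := hint ⟨b, hb⟩
    refine ⟨p, hp, ?_⟩
    have := congrArg B.val.toRingHom h0
    rw [map_zero, Polynomial.hom_eval₂] at this
    exact this
  refine le_finrank_of_algebraicIndependent (z := fun i => (φ (MvPolynomial.X i)).1)
    (fun i => (φ _).2) ?_
  have h1 : AlgebraicIndependent k (MvPolynomial.X : Fin s → MvPolynomial (Fin s) k) :=
    MvPolynomial.algebraicIndependent_X _ _
  exact h1.map' (f := B.val.comp φ) (Subtype.val_injective.comp hinj)

end LieAlgebra

/-! ### Orbit dimensions -/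

section Orbits

variable {k : Type u} [Field k] {G : Type v} [Group G] [AffineAlgebraicGroup k G]
  {V : Type w} [AddCommGroup V] [Module k V]

/-- A linear isomorphism carrying `S` onto a set containing `T` does not decrease dimension. -/
theorem zariskiDim_le_of_linearEquiv {W : Type*} [AddCommGroup W] [Module k W] (e : V ≃ₗ[k] W)
    {S : Set V} {T : Set W} (h : ∀ w ∈ T, e.symm w ∈ S) :
    zariskiDim (polyFun k W) T ≤ zariskiDim (polyFun k V) S := by
  have hmem : ∀ p ∈ polyFun k V, pullback k e.symm p ∈ polyFun k W := by
    intro p hp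
    have : polyFun k V ≤ (polyFun k W).comap (pullback k e.symm) := by
      refine Algebra.adjoin_le ?_
      rintro _ ⟨ℓ, rfl⟩
      exact Algebra.subset_adjoin ⟨ℓ ∘ₗ e.symm.toLinearMap, rfl⟩
    exact this hp
  have hmem' : ∀ p ∈ polyFun k W, pullback k e p ∈ polyFun k V := by
    intro p hp
    have : polyFun k W ≤ (polyFun k V).comap (pullback k e) := by
      refine Algebra.adjoin_le ?_
      rintro _ ⟨ℓ, rfl⟩
      exact Algebra.subset_adjoin ⟨ℓ ∘ₗ e.toLinearMap, rfl⟩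
    exact this hp
  let f : polyFun k V →+* polyFun k W ⧸ vanishingIdeal (polyFun k W) T :=
    (Ideal.Quotient.mk _).comp (((pullback k e.symm).comp (polyFun k V).val).codRestrict
      (polyFun k W) fun p => hmem p.1 p.2).toRingHom
  have hf : ∀ p ∈ vanishingIdeal (polyFun k V) S, f p = 0 := fun p hp =>
    Ideal.Quotient.eq_zero_iff_mem.2 fun w hw => hp _ (h w hw)
  refine ringKrullDim_le_of_surjective (Ideal.Quotient.lift _ f hf)
    (Ideal.Quotient.lift_surjective_of_surjective _ _ ?_)
  refine Ideal.Quotient.mk_surjective.comp fun p => ⟨⟨_, hmem' p.1 p.2⟩, ?_⟩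
  refine Subtype.ext (funext fun w => ?_)
  show p.1 (e (e.symm w)) = p.1 w
  rw [e.apply_symm_apply]

/-- The subalgebra of `k[G]` of pull-backs of polynomial functions along the orbit map. -/
def orbitAlg (ρ : Representation k G V) [IsRational ρ] (v : V) : Subalgebra k (coordRing k G) :=
  Algebra.adjoin k (Set.range fun ℓ : Module.Dual k V => coeff ρ ℓ v)

theorem leftTranslate_mem_orbitAlg (ρ : Representation k G V) [IsRational ρ] (v : V) (g : G)
    {b : coordRing k G} (hb : b ∈ orbitAlg ρ v) : leftTranslate k g b ∈ orbitAlg ρ v := by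
  have h : orbitAlg ρ v ≤ (orbitAlg ρ v).comap (leftTranslate k g) := by
    refine Algebra.adjoin_le ?_
    rintro _ ⟨ℓ, rfl⟩
    refine Algebra.subset_adjoin ⟨ℓ ∘ₗ ρ g, coordRing_ext fun x => ?_⟩
    simp [coeff]
  exact h hb

/-- The coordinate ring of the orbit closure is `orbitAlg`. -/
theorem nonempty_ringEquiv_orbitAlg (ρ : Representation k G V) [IsRational ρ] (v : V) :
    Nonempty ((polyFun k V ⧸ vanishingIdeal (polyFun k V) (Set.range fun g : G => ρ g v)) ≃+*
      orbitAlg ρ v) := by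
  let π : (V → k) →ₐ[k] (G → k) := pullback k fun g : G => ρ g v
  -- Both algebras are compared inside the functions on G, where they have the same generators ℓ(g ·
  -- v).
  have himg : (polyFun k V).map π = (orbitAlg ρ v).map (coordRing k G).val := by
    rw [polyFun, orbitAlg, AlgHom.map_adjoin, AlgHom.map_adjoin, ← Set.range_comp,
      ← Set.range_comp]
    rfl
  let e : orbitAlg ρ v ≃ₐ[k] (polyFun k V).map π :=
    ((orbitAlg ρ v).equivMapOfInjective _ Subtype.val_injective).trans
      (Subalgebra.equivOfEq _ _ himg.symm)
  let f : polyFun k V →ₐ[k] (polyFun k V).map π :=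
    (π.comp (polyFun k V).val).codRestrict _ fun p => ⟨p.1, p.2, rfl⟩
  have hf : Function.Surjective f := by
    rintro ⟨_, p, hp, rfl⟩
    exact ⟨⟨p, hp⟩, rfl⟩
  have hker : vanishingIdeal (polyFun k V) (Set.range fun g : G => ρ g v) =
      RingHom.ker f := by
    ext p
    constructor
    · intro hp
      exact Subtype.ext (funext fun g => hp _ ⟨g, rfl⟩)
    · rintro hp _ ⟨g, rfl⟩
      exact congrFun (congrArg Subtype.val hp) g
  exact ⟨((Ideal.quotEquivOfEq hker).trans
    (RingHom.quotientKerEquivOfSurjective hf)).trans e.symm.toRingEquiv⟩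

variable [FiniteDimensional k V]

/-- The differential `D ↦ D · v` of the orbit map at the identity. -/
noncomputable def infOrbitMap (ρ : Representation k G V) [IsRational ρ] (v : V) :
    LieAlg k G →ₗ[k] V where
  toFun D := lieAct ρ D v
  map_add' D E := LinearMap.congr_fun (map_add (differential ρ) D E) v
  map_smul' c D := LinearMap.congr_fun (map_smul (differential ρ) c D) v

/-- Rank–nullity: the kernel of D ↦ D · v is by definition the stabiliser. -/
theorem finrank_infOrbitMap_add (ρ : Representation k G V) [IsRational ρ] (v : V) :
    Module.finrank k (LinearMap.range (infOrbitMap ρ v)) + Module.finrank k (lieStabiliser ρ v) =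
      Module.finrank k (LieAlg k G) :=
  LinearMap.finrank_range_add_finrank_ker (infOrbitMap ρ v)

/-- An algebra generated by the image of a finite-dimensional space is finitely generated. -/
theorem fg_adjoin_range {A W : Type*} [CommRing A] [Algebra k A] [AddCommGroup W] [Module k W]
    [FiniteDimensional k W] (f : W →ₗ[k] A) : (Algebra.adjoin k (Set.range f)).FG := by
  classical
  let b := Module.finBasis k W
  refine ⟨Finset.univ.image (f ∘ b), le_antisymm (Algebra.adjoin_mono ?_)
    (Algebra.adjoin_le ?_)⟩
  · intro x hx
    obtain ⟨i, -, rfl⟩ := Finset.mem_image.1 (Finset.mem_coe.1 hx)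
    exact ⟨_, rfl⟩
  · rintro _ ⟨w, rfl⟩
    rw [← b.sum_repr w, map_sum]
    refine Subalgebra.sum_mem _ fun i _ => ?_
    rw [map_smul]
    refine Subalgebra.smul_mem _ (Algebra.subset_adjoin ?_) _
    exact Finset.mem_coe.2 (Finset.mem_image_of_mem _ (Finset.mem_univ i))

theorem fg_orbitAlg (ρ : Representation k G V) [IsRational ρ] (v : V) : (orbitAlg ρ v).FG :=
  fg_adjoin_range (W := Module.Dual k V)
    { toFun := fun ℓ => coeff ρ ℓ v
      map_add' := fun _ _ => rfl
      map_smul' := fun _ _ => rfl }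

/-- On generators, D sends the coefficient of (ℓ, v) to that of (ℓ, D · v). This vanishes if D · v =
0, and conversely its value at the identity is ℓ(D · v). -/
theorem lieAnnihilator_orbitAlg (ρ : Representation k G V) [IsRational ρ] (v : V) :
    lieAnnihilator (orbitAlg ρ v) = LinearMap.ker (infOrbitMap ρ v) := by
  ext D
  constructor
  · intro hD
    refine lieAct_ext (k := k) fun ℓ => ?_
    rw [map_zero]
    refine (apply_lieAct ρ D v ℓ).trans ?_
    rw [hD _ (Algebra.subset_adjoin ⟨ℓ, rfl⟩)]
    rfl
  · intro hD b hb
    have hD' : lieAct ρ D v = 0 := hD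
    induction hb using Algebra.adjoin_induction with
    | mem x hx =>
      obtain ⟨ℓ, rfl⟩ := hx
      show D.1 (coeff ρ ℓ v) = 0
      rw [derivation_coeff, hD']
      exact coordRing_ext fun x => by simp [coeff]
    | algebraMap r => exact D.1.map_algebraMap r
    | add x y _ _ hx hy => rw [map_add, hx, hy, add_zero]
    | mul x y _ _ hx hy => rw [Derivation.leibniz, hx, hy, smul_zero, smul_zero, add_zero]

/-- In characteristic zero the dimension of an orbit is the dimension of its tangent space
`𝔤 · v`. -/
theorem orbitDim_eq_finrank [CharZero k] [IsDomain (coordRing k G)] (ρ : Representation k G V)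
    [IsRational ρ] (v : V) :
    orbitDim ρ v = (Module.finrank k (LinearMap.range (infOrbitMap ρ v)) : ℕ) := by
  obtain ⟨e⟩ := nonempty_ringEquiv_orbitAlg ρ v
  rw [orbitDim, zariskiDim, ringKrullDim_eq_of_ringEquiv e,
    ringKrullDim_eq_finrank (fg_orbitAlg ρ v) fun g b hb => leftTranslate_mem_orbitAlg ρ v g hb,
    lieAnnihilator_orbitAlg, (infOrbitMap ρ v).quotKerEquivRange.finrank_eq]

theorem mem_regularSet_iff [CharZero k] [IsDomain (coordRing k G)] (ρ : Representation k G V)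
    [IsRational ρ] (v : V) : v ∈ regularSet ρ ↔
      ∀ v', Module.finrank k (lieStabiliser ρ v) ≤ Module.finrank k (lieStabiliser ρ v') := by
  refine forall_congr' fun v' => ?_
  rw [orbitDim_eq_finrank, orbitDim_eq_finrank]
  have h1 := finrank_infOrbitMap_add ρ v
  have h2 := finrank_infOrbitMap_add ρ v'
  have h3 : ∀ m n : ℕ, (((m : ℕ∞) : WithBot ℕ∞) ≤ ((n : ℕ∞) : WithBot ℕ∞)) ↔ m ≤ n := fun m n => by
    rw [WithBot.coe_le_coe, Nat.cast_le]
  refine (h3 _ _).trans ?_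
  omega

/-- Lower semicontinuity of the rank, evaluated on a dense set: each stabiliser has dimension at
least that of some stabiliser of a point in the dense set. -/
theorem exists_mem_finrank_lieStabiliser_le (ρ : Representation k G V) [IsRational ρ] {Ω : Set V}
    (hΩ : @Dense V (zariski (polyFun k V)) Ω) (v : V) :
    ∃ w ∈ Ω, Module.finrank k (lieStabiliser ρ w) ≤ Module.finrank k (lieStabiliser ρ v) := by
  classical
  let r := Module.finrank k (LinearMap.range (infOrbitMap ρ v))
  let b := Module.finBasis k (LinearMap.range (infOrbitMap ρ v))
  choose D hD using fun i => (b i).2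
  have hli : LinearIndependent k fun i => (b i : V) :=
    b.linearIndependent.map' (Submodule.subtype _) (Submodule.ker_subtype _)
  -- L projects V onto 𝔤 · v, extending the coordinate forms of b to V; M w is then an r × r minor
  -- of the map D ↦ D · w.
  obtain ⟨L, hL⟩ :=
    (Submodule.subtype (LinearMap.range (infOrbitMap ρ v))).exists_leftInverse_of_injective
      (Submodule.ker_subtype _)
  let ℓ : Fin r → Module.Dual k V := fun j => b.coord j ∘ₗ L
  let M : V → Matrix (Fin r) (Fin r) k := fun w => Matrix.of fun i j => ℓ j (lieAct ρ (D i) w)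
  have hMv : M v = 1 := by
    ext i j
    have h1 : lieAct ρ (D i) v = b i := hD i
    have h2 : L (b i) = b i := LinearMap.congr_fun hL (b i)
    show b.coord j (L (lieAct ρ (D i) v)) = _
    rw [h1, h2, Module.Basis.coord_apply, b.repr_self, Matrix.one_apply, Finsupp.single_apply]
  have hpoly : (fun w => (M w).det) ∈ polyFun k V := by
    have : (fun w => (M w).det) = ∑ σ : Equiv.Perm (Fin r), (Equiv.Perm.sign σ : ℤ) •
        ∏ i, fun w => (ℓ i ∘ₗ differential ρ (D (σ i))) w := by
      funext w
      rw [Matrix.det_apply]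
      simp only [Finset.sum_apply, Pi.smul_apply, Finset.prod_apply]
      rfl
    rw [this]
    refine Subalgebra.sum_mem _ fun σ _ => zsmul_mem (Subalgebra.prod_mem _ fun i _ => ?_) _
    exact Algebra.subset_adjoin ⟨_, rfl⟩
  let := zariski (polyFun k V)
  -- The minor is a polynomial equal to 1 at v, so it is nonzero somewhere on the dense set; there
  -- the rank is at least r.
  obtain ⟨w, hw, hwΩ⟩ := hΩ.inter_open_nonempty _ (isOpen_zariski hpoly)
    ⟨v, by simp [hMv]⟩
  refine ⟨w, hwΩ, ?_⟩
  have hrank : r ≤ Module.finrank k (LinearMap.range (infOrbitMap ρ w)) := by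
    have hli' : LinearIndependent k fun i => (⟨lieAct ρ (D i) w, D i, rfl⟩ :
        LinearMap.range (infOrbitMap ρ w)) := by
      have h1 : LinearIndependent k (M w).row :=
        Matrix.linearIndependent_rows_of_det_ne_zero hw
      refine LinearIndependent.of_comp (LinearMap.pi ℓ ∘ₗ Submodule.subtype _) ?_
      exact h1
    simpa using hli'.fintype_card_le_finrank
  have h1 := finrank_infOrbitMap_add ρ v
  have h2 := finrank_infOrbitMap_add ρ w
  omega

/-- The adjoint action as a linear map. -/
def adLinear (g : G) : LieAlg k G →ₗ[k] LieAlg k G where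
  toFun := Ad g
  map_add' _ _ := Subtype.ext (Derivation.ext fun _ => (map_add (rightTranslate k g) _ _))
  map_smul' c _ := Subtype.ext (Derivation.ext fun _ => (map_smul (rightTranslate k g) c _))

/-- A linear image has no larger dimension, so `Ad g` need not be shown invertible. -/
theorem finrank_le_of_areConjugate {𝔞 𝔟 : LieSubalgebra k (LieAlg k G)} (h : AreConjugate 𝔞 𝔟) :
    Module.finrank k 𝔟 ≤ Module.finrank k 𝔞 := by
  obtain ⟨g, hg⟩ := h
  have : 𝔟.toSubmodule = 𝔞.toSubmodule.map (adLinear g) := SetLike.coe_injective hg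
  calc Module.finrank k 𝔟.toSubmodule = Module.finrank k (𝔞.toSubmodule.map (adLinear g)) := by
        rw [this]
    _ ≤ Module.finrank k 𝔞.toSubmodule := Submodule.finrank_map_le _ _

/-- Regular points are those whose stabiliser has the dimension of a generic stabiliser. -/
theorem mem_regularSet_iff_finrank_le [CharZero k] [IsDomain (coordRing k G)]
    {ρ : Representation k G V} [IsRational ρ] {𝔥 : LieSubalgebra k (LieAlg k G)}
    (h𝔥 : IsGenericStabiliser ρ 𝔥) (v : V) :
    v ∈ regularSet ρ ↔ Module.finrank k (lieStabiliser ρ v) ≤ Module.finrank k 𝔥 := by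
  obtain ⟨Ω, -, hd, hconj, v₀, hv₀, rfl⟩ := h𝔥
  rw [mem_regularSet_iff]
  refine ⟨fun h => h v₀, fun h v' => ?_⟩
  obtain ⟨w, hw, hle⟩ := exists_mem_finrank_lieStabiliser_le ρ hd v'
  exact h.trans ((finrank_le_of_areConjugate (hconj w hw v₀ hv₀)).trans hle)

end Orbits

/-! ### Morphisms and their differentials -/

section Differential

variable {k : Type u} [Field k] {G K : Type*} [Group G] [Group K] [AffineAlgebraicGroup k G]
  [AffineAlgebraicGroup k K]

theorem finrank_le_of_le_comap {E F : Type*} [AddCommGroup E] [Module k E] [AddCommGroup F]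
    [Module k F] [FiniteDimensional k F] (f : E →ₗ[k] F) (hf : Function.Injective f)
    {S : Submodule k E} {T : Submodule k F} (h : S ≤ T.comap f) :
    Module.finrank k S ≤ Module.finrank k T :=
  LinearMap.finrank_le_finrank_of_injective (f := f.restrict h) fun _ _ e =>
    Subtype.ext (hf (congrArg Subtype.val e))

/-- The differential at the identity of a morphism `G → K` preserving the identity, given by its
comorphism `r`, on left invariant derivations. -/
noncomputable def lieMapFun (r : coordRing k K →ₐ[k] coordRing k G)
    (hr : ∀ F, (r F).1 1 = F.1 1) (D : LieAlg k G) : LieAlg k K :=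
  lieOfPoint
    { toFun := fun F => (D.1 (r F)).1 1
      map_add' := fun a b => by rw [map_add, map_add]; rfl
      map_smul' := fun c a => by rw [map_smul, Derivation.map_smul]; rfl }
    fun a b => by
      show (D.1 (r (a * b))).1 1 = a.1 1 * (D.1 (r b)).1 1 + b.1 1 * (D.1 (r a)).1 1
      rw [map_mul, Derivation.leibniz, ← hr a, ← hr b]
      rfl

theorem lieMapFun_apply_one (r : coordRing k K →ₐ[k] coordRing k G)
    (hr : ∀ F, (r F).1 1 = F.1 1) (D : LieAlg k G) (F : coordRing k K) :
    ((lieMapFun r hr D).1 F).1 1 = (D.1 (r F)).1 1 :=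
  lieOfPoint_apply_one _ _ F

/-- `lieMapFun` as a linear map. -/
noncomputable def lieMap (r : coordRing k K →ₐ[k] coordRing k G)
    (hr : ∀ F, (r F).1 1 = F.1 1) : LieAlg k G →ₗ[k] LieAlg k K where
  toFun := lieMapFun r hr
  map_add' D E := lieAlg_ext fun F => by
    show _ = ((lieMapFun r hr D).1 F).1 1 + ((lieMapFun r hr E).1 F).1 1
    rw [lieMapFun_apply_one, lieMapFun_apply_one, lieMapFun_apply_one]
    rfl
  map_smul' c D := lieAlg_ext fun F => by
    show _ = c * ((lieMapFun r hr D).1 F).1 1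
    rw [lieMapFun_apply_one, lieMapFun_apply_one]
    rfl

/-- A surjective comorphism, as for a closed embedding, means a tangent vector is determined by its
values on pulled-back functions. -/
theorem lieMap_injective (r : coordRing k K →ₐ[k] coordRing k G)
    (hr : ∀ F, (r F).1 1 = F.1 1) (hs : Function.Surjective r) :
    Function.Injective (lieMap r hr) := by
  intro D E h
  refine lieAlg_ext fun f => ?_
  obtain ⟨F, rfl⟩ := hs f
  rw [← lieMapFun_apply_one r hr, ← lieMapFun_apply_one r hr]
  exact congrArg (fun X : LieAlg k K => (X.1 F).1 1) h

/-- Stabilisers for a closed subgroup are at most as large as those for the group. -/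
theorem finrank_lieStabiliser_le_of_morphism (r : coordRing k K →ₐ[k] coordRing k G)
    (hr : ∀ F, (r F).1 1 = F.1 1) (hs : Function.Surjective r) {X Y : Type*} [AddCommGroup X]
    [Module k X] [FiniteDimensional k X] [AddCommGroup Y] [Module k Y] [FiniteDimensional k Y]
    (τ : Representation k K X) (ρ : Representation k G Y) [IsRational τ] [IsRational ρ]
    (e : X ≃ₗ[k] Y) (x : X)
    (he : ∀ ℓ : Module.Dual k Y, r (coeff τ (ℓ ∘ₗ e.toLinearMap) x) = coeff ρ ℓ (e x)) :
    Module.finrank k (lieStabiliser ρ (e x)) ≤ Module.finrank k (lieStabiliser τ x) := by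
  -- The differential of the group morphism intertwines the two infinitesimal actions at x, so it
  -- carries one stabiliser into the other.
  have hact : ∀ D, e (lieAct τ (lieMap r hr D) x) = lieAct ρ D (e x) := fun D =>
    lieAct_ext (k := k) fun ℓ => by
      refine (apply_lieAct τ (lieMap r hr D) x (ℓ ∘ₗ e.toLinearMap)).trans ?_
      rw [apply_lieAct, ← he]
      exact lieMapFun_apply_one r hr D _
  have hle : (lieStabiliser ρ (e x)).toSubmodule ≤
      (lieStabiliser τ x).toSubmodule.comap (lieMap r hr) := by
    intro D hD
    refine e.injective ?_
    rw [map_zero]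
    exact (hact D).trans hD
  exact finrank_le_of_le_comap (lieMap r hr) (lieMap_injective r hr hs) hle

end Differential

/-! ### Comparing the two representations -/

section Comparison

variable {k : Type u} [Field k] {G H : Type*} [Group G] [Group H] {V W : Type*} [AddCommGroup V]
  [Module k V] [AddCommGroup W] [Module k W] [FiniteDimensional k W]

/-- The isomorphism `V ⊗ W ≃ V^d` given by a basis of `W`. -/
noncomputable def tensorEquivPow (V W : Type*) [AddCommGroup V] [Module k V] [AddCommGroup W]
    [Module k W] [FiniteDimensional k W] : V ⊗[k] W ≃ₗ[k] (Fin (Module.finrank k W) → V) :=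
  (TensorProduct.congr (LinearEquiv.refl k V) (Module.finBasis k W).equivFun).trans
    (TensorProduct.piScalarRight k k V _)

/-- G₁ leaves the second factor alone, so each coordinate with respect to the basis of W is an
independent copy of V. -/
theorem tensorEquivPow_boxTensor (ρ : Representation k G V) (σ : Representation k H W) (g : G)
    (x : V ⊗[k] W) : tensorEquivPow V W (boxTensor ρ σ (g, 1) x) =
      powRep ρ _ g (tensorEquivPow V W x) := by
  induction x with
  | zero => simp
  | add x y hx hy => simp only [map_add, hx, hy]
  | tmul v w =>
    have h1 : boxTensor ρ σ (g, 1) (v ⊗ₜ w) = ρ g v ⊗ₜ w := by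
      show ρ g v ⊗ₜ σ 1 w = _
      rw [map_one]
      rfl
    have h2 : ∀ (y : V) i, tensorEquivPow V W (y ⊗ₜ w) i =
        (Module.finBasis k W).repr w i • y := fun y i => by
      simp [tensorEquivPow]
    rw [h1]
    funext i
    show _ = ρ g (tensorEquivPow V W (v ⊗ₜ w) i)
    rw [h2, h2, map_smul]

variable [AffineAlgebraicGroup k G] [AffineAlgebraicGroup k H]

/-- Restriction of regular functions from `G × H` to `G × {1}`. -/
def restrictFst : coordRing k (G × H) →ₐ[k] coordRing k G :=
  ((pullback k fun g : G => (g, (1 : H))).comp (coordRing k (G × H)).val).codRestrict _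
    fun F => slice_right_mem F.2 1

theorem restrictFst_surjective :
    Function.Surjective (restrictFst : coordRing k (G × H) →ₐ[k] coordRing k G) :=
  fun f => ⟨⟨_, fst_mem f.2⟩, rfl⟩

theorem finrank_lieStabiliser_powRep_le [FiniteDimensional k V] (ρ : Representation k G V)
    (σ : Representation k H W) [IsRational ρ] [IsRational σ] (x : V ⊗[k] W) :
    Module.finrank k (lieStabiliser (powRep ρ (Module.finrank k W)) (tensorEquivPow V W x)) ≤
      Module.finrank k (lieStabiliser (boxTensor ρ σ) x) :=
  finrank_lieStabiliser_le_of_morphism restrictFst (fun _ => rfl) restrictFst_surjective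
    (boxTensor ρ σ) (powRep ρ (Module.finrank k W)) (tensorEquivPow V W) x
    fun ℓ => coordRing_ext fun g => congrArg ℓ (tensorEquivPow_boxTensor ρ σ g x)

end Comparison

end CodimTwo

open CodimTwo
theorem mainTheorem9
    {k : Type*} [Field k] [IsAlgClosed k] [CharZero k]
    {G₁ G₂ : Type*} [Group G₁] [Group G₂]
    [AffineAlgebraicGroup k G₁] [AffineAlgebraicGroup k G₂]
    (hG₁ : IsZariskiConnected k G₁) (hG₂ : IsZariskiConnected k G₂)
    {V₁ V₂ : Type*} [AddCommGroup V₁] [Module k V₁] [FiniteDimensional k V₁]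
    [AddCommGroup V₂] [Module k V₂] [FiniteDimensional k V₂]
    (ρ₁ : Representation k G₁ V₁) (ρ₂ : Representation k G₂ V₂)
    [IsRational ρ₁] [IsRational ρ₂]
    (hC : CodimCondition 2 (boxTensor ρ₁ ρ₂))
    (𝔥 : LieSubalgebra k (LieAlg k (G₁ × G₂)))
    (h𝔥 : IsGenericStabiliser (boxTensor ρ₁ ρ₂) 𝔥)
    (𝔥₁ : LieSubalgebra k (LieAlg k G₁))
    (h𝔥₁ : IsGenericStabiliser (powRep ρ₁ (Module.finrank k V₂)) 𝔥₁)
    (heq : Nonempty (𝔥 ≃ₗ⁅k⁆ 𝔥₁)) :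
    CodimCondition 2 (powRep ρ₁ (Module.finrank k V₂)) := by
  have := isDomain_coordRing hG₁
  have := isDomain_coordRing hG₂
  have : IsDomain (coordRing k (G₁ × G₂)) :=
    isDomain_prodAlg (A := coordRing k G₁) (B := coordRing k G₂)
  obtain ⟨φ⟩ := heq
  have hdim : Module.finrank k 𝔥 = Module.finrank k 𝔥₁ := φ.toLinearEquiv.finrank_eq
  -- Of the isomorphism of generic stabilisers only the equality of dimensions matters: the smaller
  -- stabiliser in 𝔤₁ stays below the common bound.
  have hreg : ∀ x ∈ regularSet (boxTensor ρ₁ ρ₂),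
      tensorEquivPow V₁ V₂ x ∈ regularSet (powRep ρ₁ (Module.finrank k V₂)) := by
    intro x hx
    rw [mem_regularSet_iff_finrank_le h𝔥] at hx
    rw [mem_regularSet_iff_finrank_le h𝔥₁, ← hdim]
    exact (finrank_lieStabiliser_powRep_le ρ₁ ρ₂ x).trans hx
  have hle := zariskiDim_le_of_linearEquiv (tensorEquivPow V₁ V₂)
    (S := (regularSet (boxTensor ρ₁ ρ₂))ᶜ)
    (T := (regularSet (powRep ρ₁ (Module.finrank k V₂)))ᶜ) fun w hw h => hw (by
      simpa using hreg _ h)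
  rw [CodimCondition, ← (tensorEquivPow V₁ V₂).finrank_eq]
  exact (add_le_add_left hle _).trans hC
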